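/- Let $k$ be any scheme and $0\le i\le n$ integers. Let $V=\mathcal O_k^{2n+2}$ carry the standard symplectic form $\phi$ with symplectic basis $e_1,f_1,\dots,e_{n+1},f_{n+1}$ ($\phi(e_j,f_j)=1$, the form being the orthogonal sum of the hyperbolic planes $\langle e_j,f_j\rangle$), and let $E_j=\langle e_1,\dots,e_j\rangle$, a totally isotropic subbundle. Let $\mathrm{HP}^n\subset \mathrm{Gr}(2,V)$ be the open subscheme parametrizing the rank $2$ subbundles $U\subset V$ on which $\phi$ is nondegenerate, and put $\overline X_{2j}=\mathrm{Gr}(2,E_j^{\perp})\cap \mathrm{HP}^n$ and $X_{2i}=\overline X_{2i}\smallsetminus\overline X_{2i+2}$, with $\overline X_{2i}$ closed in $\mathrm{HP}^n$ and $X_{2i}$ open in $\overline X_{2i}$. That is, $X_{2i}$ is the $k$-scheme such that for every affine $k$-scheme $\operatorname{Spec}R$ the set $X_{2i}(R)$ is, naturally in $\operatorname{Spec}R$, the set of rank $2$ subbundles $U\subset R^{2n+2}$ with $\phi|_U$ nondegenerate and $U\subset E_i^\perp$ such that at no field-valued point of $\operatorname{Spec}R$ the fibre of $U$ is contained in $E_{i+1}^\perp$.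 Such a $k$-scheme exists (it is then unique up to unique isomorphism), and the following holds. (a) The formula $$t\cdot(\alpha,a,\beta,b,r)=(\alpha,\,a,\,\beta+t\alpha,\,b+ta,\,r+t(1-\phi(a,b))),$$ where $\phi$ now also denotes the standard symplectic form $\mathbb A^{2n-2i}\times\mathbb A^{2n-2i}\to\mathbb A^1$, defines a free action of the additive group $\mathbb G_a$ over $k$ on $$\mathbb A_k^{4n-2i+1}=\mathbb A^{i}\times\mathbb A^{2n-2i}\times\mathbb A^{i}\times\mathbb A^{2n-2i}\times\mathbb A^{1},$$ and $X_{2i}$ is the quotient of $\mathbb A_k^{4n-2i+1}$ by this action: there is a $k$-morphism $\pi\colon\mathbb A_k^{4n-2i+1}\to X_{2i}$ which is a Zariski locally trivial principal $\mathbb G_a$-bundle for this action and is its categorical quotient in $k$-schemes. (b) Let $\mathcal V$ be a full subcategory of the category of $k$-schemes, closed under isomorphism, all of whose objects are quasi-compact and quasi-separated, which contains $k$ and $\varnothing$, is closed under $X\sqcup Y$, $X\times_kY$ and passage to quasi-compact open subschemes, and contains every $Y$ for which there are $X\in\mathcal V$ and an affine morphism $Y\to X$ that identifies $Y$ with an open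 subscheme of a Grassmannian bundle $\mathrm{Gr}(r,\mathcal O_X^N)$ over $X$. Let $(A,\partial)$ be a cohomology theory on $\mathcal V$: a contravariant functor $(X,Z)\mapsto A_Z(X)$ to abelian groups on pairs of a scheme $X$ and a closed subset $Z\subset X$ with $X,\,X\smallsetminus Z\in\mathcal V$ (a map $(X',Z')\to(X,Z)$ being a $k$-morphism $f\colon X'\to X$ with $f^{-1}(Z)\subset Z'$; one writes $A(X)=A_X(X)$), with natural maps $\partial\colon A(X\smallsetminus Z)\to A_Z(X)$ such that $$A(X\smallsetminus Z)\xrightarrow{\partial}A_Z(X)\to A(X)\to A(X\smallsetminus Z)\xrightarrow{\partial}A_Z(X)$$ is exact, $A_Z(X)\to A_{Z'}(X')$ is an isomorphism whenever $f\colon X'\to X$ is étale, $Z'=f^{-1}(Z)$ and $f$ induces an isomorphism $Z'\to Z$ (reduced structures), and $A(X)\to A(X\times\mathbb A^1)$ is an isomorphism for every $X\in\mathcal V$. Then for every $S\in\mathcal V$ the scheme $X_{2i}\times_kS$ lies in $\mathcal V$, and pullback along the projection $X_{2i}\times_k S\to S$ is an isomorphism $A(S)\cong A(X_{2i}\times_k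 S)$. -/

import Mathlib

open CategoryTheory Limits MonoidalCategory CartesianMonoidalCategory AlgebraicGeometry Opposite
open TopologicalSpace (Closeds)

universe w u

noncomputable section

namespace QuatProj

/-! ### Subbundles of trivial bundles over affine schemes -/

section Subbundles

variable {R : Type u} [CommRing R]

/-- `U ⊆ R^ι` is a subbundle of rank `r` of the trivial bundle on `Spec R`: the quotient is
projective (so `U` is locally a direct summand) and `U` has rank `r` at every point.
For finite `ι` these `U` are the `R`-points of the Grassmannian `Gr(r, ι)`. -/
structure IsSubbundle {ι : Type} (r : ℕ) (U : Submodule R (ι → R)) : Prop where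
  projective_quotient : Module.Projective R ((ι → R) ⧸ U)
  rank_eq : ∀ p : PrimeSpectrum R, Module.rankAtStalk (R := R) U p = r

/-- The pullback of a subbundle of a trivial bundle along `R → R'`. (For a subbundle `U`, the map
`R' ⊗ U → (R')^ι` is injective, and this is its image.) -/
def pullbackSub {R' : Type u} [CommRing R'] {ι : Type} (g : R →+* R')
    (U : Submodule R (ι → R)) : Submodule R' (ι → R') :=
  Submodule.span R' ((fun v j => g (v j)) '' (U : Set (ι → R)))

variable (R)

/-- The standard symplectic form on `R^{2m}`, the orthogonal sum of `m` hyperbolic planes. The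
vectors with index `(j, 0)` and `(j, 1)` are the symplectic basis `e_j`, `f_j`. -/
def stdForm (m : ℕ) : LinearMap.BilinForm R (Fin m × Fin 2 → R) :=
  LinearMap.mk₂ R (fun v w => ∑ j, (v (j, 0) * w (j, 1) - v (j, 1) * w (j, 0)))
    (by intros; rw [← Finset.sum_add_distrib]
        refine Finset.sum_congr rfl fun j _ => ?_
        simp only [Pi.add_apply]; ring)
    (by intros; rw [Finset.smul_sum]
        refine Finset.sum_congr rfl fun j _ => ?_
        simp only [Pi.smul_apply, smul_eq_mul]; ring)
    (by intros; rw [← Finset.sum_add_distrib]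
        refine Finset.sum_congr rfl fun j _ => ?_
        simp only [Pi.add_apply]; ring)
    (by intros; rw [Finset.smul_sum]
        refine Finset.sum_congr rfl fun j _ => ?_
        simp only [Pi.smul_apply, smul_eq_mul]; ring)

/-- The totally isotropic subspace `E_i ⊆ R^{2m}`, spanned by the first `i` vectors `e_j` of the
standard symplectic basis. -/
def flagE (m i : ℕ) : Submodule R (Fin m × Fin 2 → R) :=
  Submodule.span R {v | ∃ j : Fin m, (j : ℕ) < i ∧ v = Pi.single (j, 0) 1}

/-- The orthogonal complement `E_i^⊥` for the standard symplectic form. -/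
def flagEPerp (m i : ℕ) : Submodule R (Fin m × Fin 2 → R) :=
  (stdForm R m).orthogonal (flagE R m i)

/-- The `R`-points of `HP^n`: rank `2` subbundles `U` of the standard symplectic bundle of rank
`2n+2` on which the form is nondegenerate (i.e. induces `U ≃ U^∨`). -/
def hpPoints (n : ℕ) : Set (Submodule R (Fin (n + 1) × Fin 2 → R)) :=
  {U | IsSubbundle 2 U ∧ ((stdForm R (n + 1)).domRestrict₁₂ U U).IsPerfPair}

/-- The `R`-points of the closed stratum `X̄_{2i} = Gr(2, E_i^⊥) ∩ HP^n`. -/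
def closedStratumPoints (n i : ℕ) : Set (Submodule R (Fin (n + 1) × Fin 2 → R)) :=
  {U | U ∈ hpPoints R n ∧ U ≤ flagEPerp R (n + 1) i}

/-- The `R`-points of the stratum `X_{2i} = X̄_{2i} ∖ X̄_{2i+2}`, an open subscheme of
`X̄_{2i}`: the points of `X̄_{2i}` over `Spec R` that lie at no field-valued point of `Spec R` in
the closed subscheme `X̄_{2i+2}`. -/
def stratumPoints (n i : ℕ) : Set (Submodule R (Fin (n + 1) × Fin 2 → R)) :=
  {U | U ∈ closedStratumPoints R n i ∧
    ∀ (K : Type u) [Field K] (g : R →+* K), pullbackSub g U ∉ closedStratumPoints K n (i + 1)}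

end Subbundles

/-! ### The strata as schemes -/

/-- The `k`-scheme `X` is the stratum `X_{2i}` of `HP^n` over `k`: it comes with a tautological
subbundle such that for every affine `k`-scheme `Spec R` the `k`-morphisms `Spec R ⟶ X` correspond
bijectively, by pullback of the tautological subbundle, to the elements of `stratumPoints R n i`.
As schemes are determined by their functors of points on affine schemes, this determines `X` up to
unique isomorphism. -/
structure IsStratum {k : Scheme.{u}} (n i : ℕ) (X : Over k) where
  taut : ∀ {R : CommRingCat.{u}}, (Spec R ⟶ X.left) → Submodule R (Fin (n + 1) × Fin 2 → R)
  taut_mem : ∀ {R : CommRingCat.{u}} (y : Spec R ⟶ X.left), taut y ∈ stratumPoints R n i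
  taut_comp : ∀ {R R' : CommRingCat.{u}} (g : R ⟶ R') (y : Spec R ⟶ X.left),
    taut (Spec.map g ≫ y) = pullbackSub g.hom (taut y)
  existsUnique : ∀ {R : CommRingCat.{u}} (x : Spec R ⟶ k),
    ∀ U ∈ stratumPoints R n i, ∃! y : Spec R ⟶ X.left, y ≫ X.hom = x ∧ taut y = U

/-! ### Affine spaces and actions of the additive group -/

/-- Affine space `A^ι` as a `k`-scheme. -/
abbrev affineSp (k : Scheme.{u}) (ι : Type u) : Over k := Over.mk (𝔸(ι; k) ↘ k)

/-- The affine line; this is also the underlying scheme of the additive group `G_a`. -/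
abbrev affineLine (k : Scheme.{u}) : Over k := affineSp k PUnit.{u + 1}

/-- The `T`-point of `A^ι` with given coordinates. -/
def pointOf {k : Scheme.{u}} {ι : Type u} (T : Over k) (v : ι → Γ(T.left, ⊤)) :
    T ⟶ affineSp k ι :=
  Over.homMk (AffineSpace.homOfVector T.hom v) (AffineSpace.homOfVector_over _ _)

/-- The coordinates of a `T`-point of `A^ι`. -/
def coordsOf {k : Scheme.{u}} {ι : Type u} {T : Over k} (x : T ⟶ affineSp k ι) :
    ι → Γ(T.left, ⊤) :=
  fun j => x.left.appTop (AffineSpace.coord k j)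

/-- A morphism `σ : G_a × P ⟶ P` on `T`-points, where `G_a(T) = Γ(T, O_T)`. -/
def actBy {k : Scheme.{u}} {P : Over k} (σ : affineLine k ⊗ P ⟶ P) {T : Over k}
    (t : Γ(T.left, ⊤)) (x : T ⟶ P) : T ⟶ P :=
  lift (pointOf T fun _ => t) x ≫ σ

/-- `σ` is an action of the additive group scheme `G_a` on `P`. -/
structure IsGaAction {k : Scheme.{u}} {P : Over k} (σ : affineLine k ⊗ P ⟶ P) : Prop where
  zero_act : ∀ {T : Over k} (x : T ⟶ P), actBy σ 0 x = x
  add_act : ∀ {T : Over k} (s t : Γ(T.left, ⊤)) (x : T ⟶ P),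
    actBy σ (s + t) x = actBy σ s (actBy σ t x)

/-- The action `σ` is free: `G_a(T)` acts freely on `P(T)` for every `k`-scheme `T`. -/
def IsFreeGa {k : Scheme.{u}} {P : Over k} (σ : affineLine k ⊗ P ⟶ P) : Prop :=
  ∀ {T : Over k} (t : Γ(T.left, ⊤)) (x : T ⟶ P), actBy σ t x = x → t = 0

/-- `π : P ⟶ X` exhibits `X` as the quotient of `P` by the action `σ` of `G_a`: it is a Zariski
locally trivial principal `G_a`-bundle (`G_a × P ≅ P ×_X P` via `(t, p) ↦ (t·p, p)`, and `π` has
sections locally on `X`), and it is the categorical quotient. -/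
structure IsGaQuotient {k : Scheme.{u}} {P X : Over k} (σ : affineLine k ⊗ P ⟶ P)
    (π : P ⟶ X) : Prop where
  isPullback : IsPullback σ (snd (affineLine k) P) π π
  locallyTrivial : ∀ x : X.left, ∃ U : X.left.Opens, x ∈ U ∧
    ∃ s : (U : Scheme.{u}) ⟶ P.left, s ≫ π.left = U.ι
  isCoequalizer : Nonempty (IsColimit (Cofork.ofπ π isPullback.w))

/-- The coordinates `(α, a, β, b, r)` on
`A^i × A^{2n-2i} × A^i × A^{2n-2i} × A^1 = A^{4n-2i+1}`. -/
abbrev CellIdx (n i : ℕ) : Type u :=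
  ULift.{u} (Fin i ⊕ (Fin (n - i) × Fin 2) ⊕ Fin i ⊕ (Fin (n - i) × Fin 2) ⊕ Unit)

/-- The formula
`t · (α, a, β, b, r) = (α, a, β + t α, b + t a, r + t (1 - φ(a, b)))`. -/
def cellFormula {R : Type u} [CommRing R] (n i : ℕ) (t : R) (x : CellIdx.{u} n i → R) :
    CellIdx.{u} n i → R :=
  let α : Fin i → R := fun j => x ⟨.inl j⟩
  let a : Fin (n - i) × Fin 2 → R := fun j => x ⟨.inr (.inl j)⟩
  let β : Fin i → R := fun j => x ⟨.inr (.inr (.inl j))⟩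
  let b : Fin (n - i) × Fin 2 → R := fun j => x ⟨.inr (.inr (.inr (.inl j)))⟩
  let r : R := x ⟨.inr (.inr (.inr (.inr ())))⟩
  fun c => match c with
    | ⟨.inl j⟩ => α j
    | ⟨.inr (.inl j)⟩ => a j
    | ⟨.inr (.inr (.inl j))⟩ => β j + t * α j
    | ⟨.inr (.inr (.inr (.inl j)))⟩ => b j + t * a j
    | ⟨.inr (.inr (.inr (.inr ())))⟩ => r + t * (1 - stdForm R (n - i) a b)

/-- The morphism `G_a × A^{4n-2i+1} ⟶ A^{4n-2i+1}` given by `cellFormula`. -/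
def cellAction (k : Scheme.{u}) (n i : ℕ) :
    affineLine k ⊗ affineSp k (CellIdx.{u} n i) ⟶ affineSp k (CellIdx.{u} n i) :=
  pointOf _ (cellFormula n i (coordsOf (fst (affineLine k) (affineSp k (CellIdx.{u} n i))) ⟨⟩)
    (coordsOf (snd (affineLine k) (affineSp k (CellIdx.{u} n i)))))

/-! ### Categories of schemes and cohomology theories -/

/-- The open subscheme `U` of `X`, over `k`. -/
abbrev openSub {k : Scheme.{u}} (X : Over k) (U : X.left.Opens) : Over k :=
  Over.mk (U.ι ≫ X.hom)

/-- `p : Y ⟶ X` identifies `Y` with an open subscheme of the Grassmannian bundle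
`Gr(r, O_X^N)` over `X`: there is a subbundle of rank `r` of `O_Y^N` such that, for every affine
scheme `Spec R` over `X` and every subbundle `M` of rank `r` of `R^N`, the functor of lifts of
`Spec R ⟶ X` to `Y` that induce `M` is represented by an open subscheme `W` of `Spec R`. -/
def IsOpenInGrassmannian {k : Scheme.{u}} (r N : ℕ) {X Y : Over k} (p : Y ⟶ X) : Prop :=
  ∃ taut : ∀ {R : CommRingCat.{u}}, (Spec R ⟶ Y.left) → Submodule R (Fin N → R),
    (∀ {R : CommRingCat.{u}} (y : Spec R ⟶ Y.left), IsSubbundle r (taut y)) ∧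
    (∀ {R R' : CommRingCat.{u}} (g : R ⟶ R') (y : Spec R ⟶ Y.left),
      taut (Spec.map g ≫ y) = pullbackSub g.hom (taut y)) ∧
    ∀ {R : CommRingCat.{u}} (x : Spec R ⟶ X.left) (M : Submodule R (Fin N → R)),
      IsSubbundle r M →
      ∃ W : (Spec R).Opens, ∀ {R' : CommRingCat.{u}} (g : R ⟶ R'),
        (∀ y y' : Spec R' ⟶ Y.left,
          y ≫ p.left = Spec.map g ≫ x → taut y = pullbackSub g.hom M →
          y' ≫ p.left = Spec.map g ≫ x → taut y' = pullbackSub g.hom M → y = y') ∧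
        ((∃ y : Spec R' ⟶ Y.left, y ≫ p.left = Spec.map g ≫ x ∧ taut y = pullbackSub g.hom M) ↔
          ∀ z : Spec R', Spec.map g z ∈ W)

/-- The conditions on a category `V` of `k`-schemes (a full subcategory of all `k`-schemes) on
which cohomology theories are considered. -/
structure IsAdmissible {k : Scheme.{u}} (V : ObjectProperty (Over k)) : Prop where
  iso_mem : ∀ {X Y : Over k}, (X ≅ Y) → V X → V Y
  compactSpace : ∀ {X : Over k}, V X → CompactSpace X.left
  quasiSeparatedSpace : ∀ {X : Over k}, V X → QuasiSeparatedSpace X.left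
  base_mem : V (Over.mk (𝟙 k))
  empty_mem : ∀ X : Over k, IsEmpty X.left → V X
  coprod_mem : ∀ {X Y : Over k}, V X → V Y → V (X ⨿ Y)
  prod_mem : ∀ {X Y : Over k}, V X → V Y → V (X ⊗ Y)
  open_mem : ∀ {X : Over k}, V X → ∀ U : X.left.Opens, IsCompact (U : Set X.left) →
    V (openSub X U)
  grassmannian_mem : ∀ {X Y : Over k} (p : Y ⟶ X) (r N : ℕ), V X → IsAffineHom p.left →
    IsOpenInGrassmannian r N p → V Y

/-- A scheme `X` and a closed subset `Z` such that `X` and `X ∖ Z` are in `V`. -/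
structure VPair {k : Scheme.{u}} (V : ObjectProperty (Over k)) where
  X : Over k
  Z : Closeds X.left
  mem : V X
  compl_mem : V (openSub X Z.compl)

/-- A morphism `(X', Z') ⟶ (X, Z)` is a `k`-morphism `f : X' ⟶ X` with `f⁻¹(Z) ⊆ Z'`. -/
@[ext]
structure VPair.Hom {k : Scheme.{u}} {V : ObjectProperty (Over k)} (P Q : VPair V) where
  f : P.X ⟶ Q.X
  preimage_le : ∀ x : P.X.left, f.left x ∈ Q.Z → x ∈ P.Z

instance {k : Scheme.{u}} {V : ObjectProperty (Over k)} : Category (VPair V) where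
  Hom := VPair.Hom
  id P := ⟨𝟙 _, fun x hx => by simpa using hx⟩
  comp F G := ⟨F.f ≫ G.f, fun x hx => F.preimage_le x (G.preimage_le _ (by simpa using hx))⟩
  id_comp F := VPair.Hom.ext (Category.id_comp _)
  comp_id F := VPair.Hom.ext (Category.comp_id _)
  assoc F G H := VPair.Hom.ext (Category.assoc _ _ _)

section Pairs

variable {k : Scheme.{u}} {V : ObjectProperty (Over k)} (hV : IsAdmissible V)

/-- The pair `(X, X)`; its cohomology is `A(X) = A_X(X)`. -/
def fullPair (X : Over k) (hX : V X) : VPair V where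
  X := X
  Z := ⊤
  mem := hX
  compl_mem := hV.empty_mem _ ⟨fun x => x.2 trivial⟩

/-- A morphism `X' ⟶ X` as a morphism of pairs `(X', X') ⟶ (X, X)`. -/
def fullMap {X' X : Over k} (hX' : V X') (hX : V X) (f : X' ⟶ X) :
    fullPair hV X' hX' ⟶ fullPair hV X hX :=
  VPair.Hom.mk f fun _ _ => trivial

/-- The pair `(X ∖ Z, X ∖ Z)` attached to `(X, Z)`. -/
def complPair (P : VPair V) : VPair V := fullPair hV (openSub P.X P.Z.compl) P.compl_mem

/-- The morphism `(X, X) ⟶ (X, Z)` given by the identity; it induces the extension of supports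
`A_Z(X) → A(X)`. -/
def extMap (P : VPair V) : fullPair hV P.X P.mem ⟶ P :=
  VPair.Hom.mk (𝟙 P.X) fun _ _ => trivial

/-- The inclusion `X ∖ Z ⟶ X`, inducing the restriction `A(X) → A(X ∖ Z)`. -/
def resMap (P : VPair V) : complPair hV P ⟶ fullPair hV P.X P.mem :=
  fullMap hV P.compl_mem P.mem (Over.homMk (Scheme.Opens.ι P.Z.compl))

end Pairs

/-- A cohomology theory `(A, ∂)` on the category `V` of `k`-schemes. -/
structure CohomologyTheory {k : Scheme.{u}} {V : ObjectProperty (Over k)}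
    (hV : IsAdmissible V) where
  /-- The functor `(X, Z) ↦ A_Z(X)`. -/
  A : (VPair V)ᵒᵖ ⥤ AddCommGrpCat.{w}
  /-- The boundary maps `∂ : A(X ∖ Z) → A_Z(X)`. -/
  bd : ∀ P : VPair V, A.obj (op (complPair hV P)) ⟶ A.obj (op P)
  /-- Naturality of `∂`: here `g` is the map `X' ∖ Z' ⟶ X ∖ Z` induced by `f`. -/
  bd_natural : ∀ {P Q : VPair V} (f : P ⟶ Q) (g : complPair hV P ⟶ complPair hV Q),
    g ≫ resMap hV Q = resMap hV P ≫ fullMap hV P.mem Q.mem f.f →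
    bd Q ≫ A.map f.op = A.map g.op ≫ bd P
  /-- Localization. -/
  exact_supp : ∀ P : VPair V, Function.Exact (bd P) (A.map (extMap hV P).op)
  exact_total : ∀ P : VPair V,
    Function.Exact (A.map (extMap hV P).op) (A.map (resMap hV P).op)
  exact_open : ∀ P : VPair V, Function.Exact (A.map (resMap hV P).op) (bd P)
  /-- Étale excision: `f` is étale, `Z' = f⁻¹(Z)`, and `f` induces an isomorphism from
  `f⁻¹(Z)` to `Z`, where `Z` has the reduced scheme structure (and hence so has
  `f⁻¹(Z) = Z ×_X X'`, as `f` is étale). -/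
  excision : ∀ {P Q : VPair V} (f : P ⟶ Q), Etale f.f.left →
    (∀ x : P.X.left, f.f.left x ∈ Q.Z ↔ x ∈ P.Z) →
    IsIso (pullback.fst (Scheme.IdealSheafData.vanishingIdeal Q.Z).subschemeι f.f.left) →
    IsIso (A.map f.op)
  /-- Homotopy invariance. -/
  homotopy : ∀ (X : Over k) (hX : V X) (hXA : V (X ⊗ affineLine k)),
    IsIso (A.map (fullMap hV hXA hX (fst X (affineLine k))).op)

/-- The pullback `f^A : A(X) → A(X')` along `f : X' ⟶ X`. -/
def CohomologyTheory.pull {k : Scheme.{u}} {V : ObjectProperty (Over k)} {hV : IsAdmissible V}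
    (A : CohomologyTheory.{w} hV) {X' X : Over k} (hX' : V X') (hX : V X) (f : X' ⟶ X) :
    A.A.obj (op (fullPair hV X hX)) ⟶ A.A.obj (op (fullPair hV X' hX')) :=
  A.A.map (fullMap hV hX' hX f).op

end QuatProj

end

open QuatProj

/-! A plane `U` on which `φ` is nondegenerate has its second exterior power trivialized by `φ`, so
it carries a unique bivector `W` with `φ(W) = 1`. Thus such planes in `E_i^⊥` are the solutions of
the Plücker relations together with one inhomogeneous linear equation, and they form a scheme affine
over `k`. The stratum is the open part where the linear form `x ↦ x_f`, with `f = f_{i+1}`, vanishes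
at no point identically on `U`. This gives the model `stratumScheme`; an object with the same
functor of points is isomorphic to it (`IsStratum.nonempty_iso`).

On `U` the linear form `x ↦ x_f` is `φ(u, ·)` for a unique `u` in `U`, and `u_f = 0`. Over an affine
base there is `v` in `U` with `v_f = 1`; then `φ(u, v) = 1`, `W = u ∧ v`, and `v` is unique up to `v
↦ v + t u`. Given `u_f = 0` and `v_f = 1`, the equation `φ(u, v) = 1` merely determines the
`e_{i+1}`-coordinate of `u` as `1 - φ(a, b)`. The pairs `(u, v)` therefore form an affine space, on
which `v ↦ v + t u` is the stated action. It is free because `φ(t u, v) = t`, and its orbits are the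
fibres of `(u, v) ↦ U` (`eq_cellFormula_of_cellW_eq`, `isPullback_cellProj`). Lifts exist over every
affine scheme (`exists_cellProj_lift`), so this map is a Zariski locally trivial torsor, and a
locally split morphism is the coequalizer of its kernel pair.

For cohomology, the scheme of Plücker coordinates times `S` is affine over `S` and is the open part
of a Grassmannian bundle where the values of the form generate the unit ideal; this puts the stratum
times `S` in `V`. Mayer–Vietoris and homotopy invariance show that pullback along the torsor is an
isomorphism (`isIso_pull_of_locally_trivOver`). So is pullback from `S` to affine space over `S`,
and the projection from the stratum follows by two out of three. -/

noncomputable section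

namespace QuatProj

/-! ### Subbundles -/

section SubbundleLemmas

variable {R : Type u} [CommRing R] {κ : Type}

lemma pullbackSub_span {R' : Type u} [CommRing R'] (g : R →+* R') (S : Set (κ → R)) :
    pullbackSub g (Submodule.span R S) = Submodule.span R' ((fun v j => g (v j)) '' S) := by
  refine le_antisymm (Submodule.span_le.2 ?_) (Submodule.span_mono (Set.image_mono
    Submodule.subset_span))
  rintro _ ⟨v, hv, rfl⟩
  induction hv using Submodule.span_induction with
  | mem x hx => exact Submodule.subset_span ⟨x, hx, rfl⟩
  | zero =>
    have : (fun (v : κ → R) j => g (v j)) 0 = 0 := funext fun j => map_zero g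
    rw [SetLike.mem_coe, this]
    exact Submodule.zero_mem _
  | add x y _ _ hx hy => simpa [Pi.add_def] using Submodule.add_mem _ hx hy
  | smul a x _ hx => simpa [Pi.smul_def] using Submodule.smul_mem _ (g a) hx

lemma projective_quotient_of_retraction [Finite κ] {U : Submodule R (κ → R)}
    (q : (κ → R) →ₗ[R] (κ → R)) (hq : ∀ x, q x ∈ U) (hqU : ∀ x ∈ U, q x = x) :
    Module.Projective R ((κ → R) ⧸ U) := by
  refine Module.Projective.of_split
    (U.liftQ (LinearMap.id - q) fun x hx => by simp [hqU x hx]) U.mkQ ?_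
  ext1
  ext1 x
  simp [hq]

lemma IsSubbundle.exists_retraction {r : ℕ} {U : Submodule R (κ → R)} (h : IsSubbundle r U) :
    ∃ q : (κ → R) →ₗ[R] U, ∀ x : U, q x = x := by
  have := h.projective_quotient
  obtain ⟨s, hs⟩ := Module.projective_lifting_property U.mkQ LinearMap.id U.mkQ_surjective
  refine ⟨LinearMap.codRestrict U (LinearMap.id - s ∘ₗ U.mkQ) fun x => ?_, fun x => ?_⟩
  · have := LinearMap.congr_fun hs (U.mkQ x)
    simp only [LinearMap.comp_apply, LinearMap.id_apply] at this
    rw [← Submodule.Quotient.mk_eq_zero U]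
    simp only [Submodule.mkQ_apply] at this
    simp [this]
  · ext1
    simp [(Submodule.Quotient.mk_eq_zero U).2 x.2]

lemma IsSubbundle.finite [Finite κ] {r : ℕ} {U : Submodule R (κ → R)} (h : IsSubbundle r U) :
    Module.Finite R U := by
  obtain ⟨q, hq⟩ := h.exists_retraction
  exact Module.Finite.of_surjective q fun x => ⟨x, hq x⟩

lemma IsSubbundle.projective [Finite κ] {r : ℕ} {U : Submodule R (κ → R)} (h : IsSubbundle r U) :
    Module.Projective R U := by
  obtain ⟨q, hq⟩ := h.exists_retraction
  exact Module.Projective.of_split U.subtype q (by ext1 x; simpa using hq x)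

/-- Locally, a subbundle of rank `r` is spanned by `r` sections. -/
lemma IsSubbundle.exists_local_generators [Finite κ] {r : ℕ} {U : Submodule R (κ → R)}
    (h : IsSubbundle r U) (p : PrimeSpectrum R) :
    ∃ b : Fin r → κ → Localization.AtPrime p.asIdeal, ∀ x ∈ U, ∃ c : Fin r →
      Localization.AtPrime p.asIdeal, ∀ a, algebraMap R _ (x a) = ∑ i, c i * b i a := by
  have := h.finite
  have := h.projective
  let Rp := Localization.AtPrime p.asIdeal
  let M := TensorProduct R Rp U
  have : Module.Free Rp M := Module.free_of_flat_of_isLocalRing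
  have hr : Module.finrank Rp M = r := by
    rw [← Module.rankAtStalk_eq_finrank_tensorProduct, h.rank_eq]
  let b : Module.Basis (Fin r) Rp M := Module.finBasisOfFinrankEq Rp M hr
  let ev (a : κ) : M →ₗ[Rp] Rp :=
    TensorProduct.AlgebraTensorModule.rid R Rp Rp ∘ₗ
      TensorProduct.AlgebraTensorModule.lTensor Rp Rp (LinearMap.proj a ∘ₗ U.subtype)
  have hev (a : κ) (x : U) : ev a (1 ⊗ₜ x) = algebraMap R Rp (x.1 a) := by
    trans TensorProduct.AlgebraTensorModule.rid R Rp Rp (1 ⊗ₜ[R] x.1 a)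
    · rfl
    · rw [TensorProduct.AlgebraTensorModule.rid_tmul, Algebra.smul_def, mul_one]
  refine ⟨fun i a => ev a (b i), fun x hx => ⟨fun i => b.repr (1 ⊗ₜ ⟨x, hx⟩) i, fun a => ?_⟩⟩
  rw [← hev a ⟨x, hx⟩]
  conv_lhs => rw [← b.sum_repr (1 ⊗ₜ ⟨x, hx⟩), map_sum]
  exact Finset.sum_congr rfl fun i _ => by rw [map_smul, smul_eq_mul]

lemma eq_zero_of_forall_localization {x : R}
    (h : ∀ p : PrimeSpectrum R, algebraMap R (Localization.AtPrime p.asIdeal) x = 0) : x = 0 :=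
  eq_zero_of_localization x fun m hm => h ⟨m, hm.isPrime⟩

/-- Maps that are mutually inverse up to a factor `r` outside `p` become isomorphisms after
localization at `p`, where `r` is a unit. -/
lemma rankAtStalk_eq_of_smul_inverse {M N : Type u} [AddCommGroup M] [AddCommGroup N] [Module R M]
    [Module R N] (p : PrimeSpectrum R) {r : R} (hr : r ∉ p.asIdeal) (f : M →ₗ[R] N)
    (h : N →ₗ[R] M) (hfh : ∀ x, f (h x) = r • x) (hhf : ∀ x, h (f x) = r • x) :
    Module.rankAtStalk (R := R) M p = Module.rankAtStalk (R := R) N p := by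
  rw [Module.rankAtStalk_eq_finrank_tensorProduct, Module.rankAtStalk_eq_finrank_tensorProduct]
  let Rp := Localization.AtPrime p.asIdeal
  have hu : IsUnit (algebraMap R Rp r) :=
    IsLocalization.map_units (M := p.asIdeal.primeCompl) Rp ⟨r, hr⟩
  have key : ∀ {M N : Type u} [AddCommGroup M] [AddCommGroup N] [Module R M]
      [Module R N] (f : M →ₗ[R] N) (h : N →ₗ[R] M), (∀ x, f (h x) = r • x) →
      ∀ y, f.baseChange Rp (h.baseChange Rp y) = algebraMap R Rp r • y := by
    intro M N _ _ _ _ f h hfh y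
    have : (f.baseChange Rp ∘ₗ h.baseChange Rp) = algebraMap R Rp r • LinearMap.id := by
      ext x
      simp [hfh]
    exact LinearMap.congr_fun this y
  refine (LinearEquiv.ofBijective (f.baseChange Rp) ⟨fun x y hxy => ?_, fun y => ?_⟩).finrank_eq
  · have h1 := congrArg (h.baseChange Rp) hxy
    rw [key h f hhf, key h f hhf] at h1
    exact hu.smul_left_cancel.1 h1
  · obtain ⟨v, hv⟩ := hu
    refine ⟨h.baseChange Rp ((v⁻¹ : Rpˣ) • y), ?_⟩
    rw [key f h hfh, ← hv, ← Units.smul_def, smul_inv_smul]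

end SubbundleLemmas

/-! ### Alternating forms and Plücker coordinates -/

section Plucker

variable {R : Type u} [CommRing R] {κ J : Type} [Fintype J] (s t : J → κ)

/-- The alternating form `∑ j, x_{s j} y_{t j} - x_{t j} y_{s j}`. -/
def pform (x y : κ → R) : R := ∑ j, (x (s j) * y (t j) - x (t j) * y (s j))

lemma pform_self (x : κ → R) : pform s t x x = 0 :=
  Finset.sum_eq_zero fun _ _ => by ring

lemma pform_swap (x y : κ → R) : pform s t x y = -pform s t y x := by
  rw [pform, pform, ← Finset.sum_neg_distrib]
  exact Finset.sum_congr rfl fun _ _ => by ring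

lemma pform_add_left (x x' y : κ → R) :
    pform s t (x + x') y = pform s t x y + pform s t x' y := by
  rw [pform, pform, pform, ← Finset.sum_add_distrib]
  exact Finset.sum_congr rfl fun _ _ => by simp only [Pi.add_apply]; ring

lemma pform_smul_left (c : R) (x y : κ → R) : pform s t (c • x) y = c * pform s t x y := by
  rw [pform, pform, Finset.mul_sum]
  exact Finset.sum_congr rfl fun _ _ => by simp only [Pi.smul_apply, smul_eq_mul]; ring

lemma pform_add_right (x y y' : κ → R) :
    pform s t x (y + y') = pform s t x y + pform s t x y' := by
  rw [pform_swap, pform_add_left, pform_swap s t y, pform_swap s t y']; ring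

lemma pform_smul_right (c : R) (x y : κ → R) : pform s t x (c • y) = c * pform s t x y := by
  rw [pform_swap, pform_smul_left, pform_swap s t y]; ring

lemma pform_zero_left (y : κ → R) : pform s t (0 : κ → R) y = 0 := by
  simp [pform]

lemma pform_map {R' : Type u} [CommRing R'] (g : R →+* R') (x y : κ → R) :
    pform s t (fun a => g (x a)) (fun a => g (y a)) = g (pform s t x y) := by
  simp [pform]

/-- The Plücker coordinates of a plane on which the form `pform s t` is nondegenerate,
normalized by the condition that the form takes the value `1` on the bivector. -/
structure IsPlucker (W : κ → κ → R) : Prop where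
  alt : ∀ a, W a a = 0
  skew : ∀ a b, W a b = -W b a
  rel : ∀ a b c d, W a b * W c d - W a c * W b d + W a d * W b c = 0
  norm : ∑ j, W (s j) (t j) = 1

/-- The span of the rows of a matrix. -/
def rowSpan (W : κ → κ → R) : Submodule R (κ → R) := Submodule.span R (Set.range W)

lemma row_mem_rowSpan (W : κ → κ → R) (a : κ) : W a ∈ rowSpan W :=
  Submodule.subset_span ⟨a, rfl⟩

lemma pullbackSub_rowSpan {R' : Type u} [CommRing R'] (g : R →+* R') (W : κ → κ → R) :
    pullbackSub g (rowSpan W) = rowSpan fun a b => g (W a b) := by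
  rw [rowSpan, pullbackSub_span, rowSpan]
  congr 1
  ext x
  simp

/-- Any three vectors in `M` have vanishing `3 × 3` minors. -/
def MinorsVanish (M : Submodule R (κ → R)) : Prop :=
  ∀ x ∈ M, ∀ y ∈ M, ∀ z ∈ M, ∀ a b c,
    (x a * y b - x b * y a) * z c - (x a * y c - x c * y a) * z b
      + (x b * y c - x c * y b) * z a = 0

/-- The ideal generated by the values of the form on `M`. -/
def valueIdeal (M : Submodule R (κ → R)) : Ideal R :=
  Ideal.span {r | ∃ x ∈ M, ∃ y ∈ M, r = pform s t x y}

variable {s t}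

lemma IsPlucker.map {R' : Type u} [CommRing R'] (g : R →+* R') {W : κ → κ → R}
    (hW : IsPlucker s t W) : IsPlucker s t fun a b => g (W a b) where
  alt a := by simp [hW.alt]
  skew a b := by rw [hW.skew, map_neg]
  rel a b c d := by simp only [← map_mul, ← map_sub, ← map_add, hW.rel, map_zero]
  norm := by rw [← map_sum, hW.norm, map_one]

/-- This is `x ∧ W = 0`. It is linear in `x`, and for a row of `W` it is the Plücker relation. -/
lemma IsPlucker.smul_eq {W : κ → κ → R} (hW : IsPlucker s t W) (a b : κ) {x : κ → R}
    (hx : x ∈ rowSpan W) : W a b • x = x b • W a - x a • W b := by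
  induction hx using Submodule.span_induction with
  | mem x hx =>
    obtain ⟨c, rfl⟩ := hx
    ext d
    simp only [Pi.smul_apply, smul_eq_mul, Pi.sub_apply]
    rw [hW.skew c b, hW.skew c a]
    linear_combination hW.rel a b c d
  | zero => simp
  | add x y _ _ hx hy => rw [smul_add, hx, hy]; simp only [Pi.add_apply]; module
  | smul r x _ hx => rw [smul_comm, hx]; simp only [Pi.smul_apply, smul_eq_mul]; module

lemma IsPlucker.form_rows {W : κ → κ → R} (hW : IsPlucker s t W) (a b : κ) :
    pform s t (W a) (W b) = W a b := by
  rw [pform]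
  trans ∑ j, W a b * W (s j) (t j)
  · exact Finset.sum_congr rfl fun j _ => by linear_combination - hW.rel a b (s j) (t j)
  · rw [← Finset.mul_sum, hW.norm, mul_one]

/-- Sum `smul_eq` over the index pairs `(s j, t j)`, whose total weight is `1`. The left side makes
sense for every vector and so gives a retraction onto the plane. -/
lemma IsPlucker.eq_sum {W : κ → κ → R} (hW : IsPlucker s t W) {x : κ → R}
    (hx : x ∈ rowSpan W) : ∑ j, (x (t j) • W (s j) - x (s j) • W (t j)) = x := by
  simp only [← hW.smul_eq _ _ hx]
  rw [← Finset.sum_smul, hW.norm, one_smul]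

/-- Through the form, row `a` represents the `a`-th coordinate functional on the plane. This makes
nondegeneracy explicit. -/
lemma IsPlucker.pform_row {W : κ → κ → R} (hW : IsPlucker s t W) {x : κ → R}
    (hx : x ∈ rowSpan W) (a : κ) : pform s t x (W a) = x a := by
  conv_rhs => rw [← hW.eq_sum hx]
  simp only [Finset.sum_apply, Pi.sub_apply, Pi.smul_apply, smul_eq_mul]
  rw [pform]
  exact Finset.sum_congr rfl fun j _ => by rw [hW.skew _ a, hW.skew _ a]; ring

lemma IsPlucker.valueIdeal_eq_top {W : κ → κ → R} (hW : IsPlucker s t W) :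
    valueIdeal s t (rowSpan W) = ⊤ := by
  rw [Ideal.eq_top_iff_one, ← hW.norm]
  refine Ideal.sum_mem _ fun j _ => Ideal.subset_span
    ⟨_, row_mem_rowSpan W (s j), _, row_mem_rowSpan W (t j), (hW.form_rows _ _).symm⟩

/-- The retraction comes from `eq_sum`. For the rank at `p`, the normalization forces some `W (s j)
(t j)` outside `p`; up to this factor, `x ↦ (x_t, -x_s)` and `(c₀, c₁) ↦ c₀ W_s + c₁ W_t` are
inverse to each other. -/
lemma IsPlucker.isSubbundle [Finite κ] {W : κ → κ → R} (hW : IsPlucker s t W) :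
    IsSubbundle 2 (rowSpan W) where
  projective_quotient := by
    refine projective_quotient_of_retraction (∑ j, ((LinearMap.proj (t j)).smulRight (W (s j)) -
      (LinearMap.proj (s j)).smulRight (W (t j)))) (fun x => ?_) fun x hx => ?_
    · simp only [LinearMap.sum_apply, LinearMap.sub_apply, LinearMap.smulRight_apply]
      exact Submodule.sum_mem _ fun j _ => Submodule.sub_mem _
        (Submodule.smul_mem _ _ (row_mem_rowSpan W _)) (Submodule.smul_mem _ _ (row_mem_rowSpan W _))
    · simpa using hW.eq_sum hx
  rank_eq p := by
    obtain ⟨j, hj⟩ : ∃ j, W (s j) (t j) ∉ p.asIdeal := by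
      by_contra! h
      exact p.isPrime.ne_top (p.asIdeal.eq_top_iff_one.2 (hW.norm ▸ Ideal.sum_mem _ fun j _ => h j))
    have : Nontrivial R := p.nontrivial
    let W' (a : κ) : rowSpan W := ⟨W a, row_mem_rowSpan W a⟩
    rw [rankAtStalk_eq_of_smul_inverse (M := rowSpan W) (N := Fin 2 → R) p hj
      (LinearMap.pi ![LinearMap.proj (t j) ∘ₗ Submodule.subtype _,
        - (LinearMap.proj (s j) ∘ₗ Submodule.subtype _)])
      ((LinearMap.proj 0).smulRight (W' (s j)) + (LinearMap.proj 1).smulRight (W' (t j)))]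
    · simp
    · intro x
      ext i
      fin_cases i
      · simp [W', hW.alt, mul_comm]
      · simp [W', hW.alt, mul_comm, hW.skew (t j) (s j)]
    · intro x
      ext1
      simpa [W', sub_eq_add_neg] using (hW.smul_eq _ _ x.2).symm

/-- Locally the three vectors are combinations of two, so their `3 × 3` minors are zero. -/
lemma IsSubbundle.minorsVanish [Finite κ] {M : Submodule R (κ → R)} (h : IsSubbundle 2 M) :
    MinorsVanish M := by
  intro x hx y hy z hz a b c
  refine eq_zero_of_forall_localization fun p => ?_
  obtain ⟨e, he⟩ := h.exists_local_generators p
  obtain ⟨cx, hx⟩ := he x hx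
  obtain ⟨cy, hy⟩ := he y hy
  obtain ⟨cz, hz⟩ := he z hz
  simp only [map_add, map_sub, map_mul, hx, hy, hz, Fin.sum_univ_two]
  ring

/-- The minors are trilinear, so it suffices to treat the generators of the pullback. This property
replaces the statement that the pullback of a subbundle is again a subbundle. -/
lemma MinorsVanish.pullback {R' : Type u} [CommRing R'] (g : R →+* R') {M : Submodule R (κ → R)}
    (h : MinorsVanish M) : MinorsVanish (pullbackSub g M) := by
  intro x hx y hy z hz a b c
  induction hx using Submodule.span_induction with
  | zero => simp
  | add x x' _ _ h1 h2 => simp only [Pi.add_apply]; linear_combination h1 + h2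
  | smul r x _ h1 => simp only [Pi.smul_apply, smul_eq_mul]; linear_combination r * h1
  | mem x hx =>
  obtain ⟨x, hx, rfl⟩ := hx
  induction hy using Submodule.span_induction with
  | zero => simp
  | add x x' _ _ h1 h2 => simp only [Pi.add_apply]; linear_combination h1 + h2
  | smul r x _ h1 => simp only [Pi.smul_apply, smul_eq_mul]; linear_combination r * h1
  | mem y hy =>
  obtain ⟨y, hy, rfl⟩ := hy
  induction hz using Submodule.span_induction with
  | zero => simp
  | add x x' _ _ h1 h2 => simp only [Pi.add_apply]; linear_combination h1 + h2
  | smul r x _ h1 => simp only [Pi.smul_apply, smul_eq_mul]; linear_combination r * h1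
  | mem z hz =>
  obtain ⟨z, hz, rfl⟩ := hz
  simp only [← map_mul, ← map_sub, ← map_add, h x hx y hy z hz, map_zero]

lemma valueIdeal_pullback {R' : Type u} [CommRing R'] (g : R →+* R') (M : Submodule R (κ → R)) :
    valueIdeal s t (pullbackSub g M) = (valueIdeal s t M).map g := by
  refine le_antisymm (Ideal.span_le.2 ?_) (Ideal.map_le_iff_le_comap.2 (Ideal.span_le.2 ?_))
  · rintro _ ⟨x, hx, y, hy, rfl⟩
    rw [SetLike.mem_coe]
    induction hx using Submodule.span_induction with
    | zero => simp [pform_zero_left]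
    | add x x' _ _ h1 h2 => rw [pform_add_left]; exact Ideal.add_mem _ h1 h2
    | smul r x _ h1 => rw [pform_smul_left]; exact Ideal.mul_mem_left _ _ h1
    | mem x hx =>
    obtain ⟨x, hx, rfl⟩ := hx
    induction hy using Submodule.span_induction with
    | zero => rw [pform_swap]; simp [pform_zero_left]
    | add x x' _ _ h1 h2 => rw [pform_add_right]; exact Ideal.add_mem _ h1 h2
    | smul r x _ h1 => rw [pform_smul_right]; exact Ideal.mul_mem_left _ _ h1
    | mem y hy =>
    obtain ⟨y, hy, rfl⟩ := hy
    rw [pform_map]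
    exact Ideal.mem_map_of_mem _ (Ideal.subset_span ⟨x, hx, y, hy, rfl⟩)
  · rintro _ ⟨x, hx, y, hy, rfl⟩
    refine Ideal.subset_span ⟨_, Submodule.subset_span ⟨x, hx, rfl⟩, _,
      Submodule.subset_span ⟨y, hy, rfl⟩, (pform_map s t g x y).symm⟩

/-- A family of planes on which the form is nondegenerate has Plücker coordinates. -/
lemma MinorsVanish.exists_isPlucker {M : Submodule R (κ → R)} (h : MinorsVanish M)
    (hM : valueIdeal s t M = ⊤) : ∃ W, IsPlucker s t W ∧ rowSpan W = M := by
  -- The bivector `x ∧ y` contracts with the form to `φ(x, y)`. The conditions imposed here are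
  -- linear in `W`, so the contraction can be any element of the value ideal, in particular `1`. The
  -- quadratic Plücker relation is left out and is recovered by taking a row of `W` for `z`.
  have key : ∀ r ∈ valueIdeal s t M, ∃ W : κ → κ → R, (∀ a, W a a = 0) ∧ (∀ a b, W a b = -W b a) ∧
      (∀ a, W a ∈ M) ∧ (∀ z ∈ M, ∀ a b c, W a b * z c - W a c * z b + W b c * z a = 0) ∧
      ∑ j, W (s j) (t j) = r := by
    intro r hr
    induction hr using Submodule.span_induction with
    | mem r hr =>
      obtain ⟨x, hx, y, hy, rfl⟩ := hr
      refine ⟨fun a b => x a * y b - x b * y a, fun a => by ring, fun a b => by ring, fun a => ?_,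
        fun z hz a b c => by linear_combination h x hx y hy z hz a b c, ?_⟩
      · convert Submodule.sub_mem _ (Submodule.smul_mem _ (x a) hy) (Submodule.smul_mem _ (y a) hx)
          using 1
        ext b
        simp [mul_comm]
      · rw [pform]
    | zero => exact ⟨0, by simp, by simp, by simp, by simp, by simp⟩
    | add r r' _ _ hr hr' =>
      obtain ⟨W, h1, h2, h3, h4, h5⟩ := hr
      obtain ⟨W', h1', h2', h3', h4', h5'⟩ := hr'
      refine ⟨W + W', fun a => by simp [h1, h1'], fun a b => ?_, fun a => Submodule.add_mem _ (h3 a)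
        (h3' a), fun z hz a b c => ?_, ?_⟩
      · simp only [Pi.add_apply]; rw [h2, h2']; ring
      · simp only [Pi.add_apply]; linear_combination h4 z hz a b c + h4' z hz a b c
      · simp [Finset.sum_add_distrib, h5, h5']
    | smul e r _ h1 =>
      obtain ⟨W, h1, h2, h3, h4, h5⟩ := h1
      refine ⟨e • W, fun a => by simp [h1], fun a b => ?_, fun a => Submodule.smul_mem _ e (h3 a),
        fun z hz a b c => ?_, ?_⟩
      · simp only [Pi.smul_apply, smul_eq_mul]; rw [h2]; ring
      · simp only [Pi.smul_apply, smul_eq_mul]; linear_combination e * h4 z hz a b c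
      · simp [← Finset.mul_sum, h5]
  obtain ⟨W, h1, h2, h3, h4, h5⟩ := key 1 (hM ▸ Submodule.mem_top)
  refine ⟨W, ⟨h1, h2, fun a b c d => ?_, h5⟩, le_antisymm (Submodule.span_le.2 ?_) fun z hz => ?_⟩
  · have := h4 _ (h3 d) a b c
    rw [h2 d c, h2 d b, h2 d a] at this
    linear_combination -this
  · rintro _ ⟨a, rfl⟩
    exact h3 a
  · have : z = ∑ j, (z (t j) • W (s j) - z (s j) • W (t j)) := by
      have h6 : z = ∑ j, W (s j) (t j) • z := by rw [← Finset.sum_smul, h5, one_smul]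
      conv_lhs => rw [h6]
      refine Finset.sum_congr rfl fun j _ => ?_
      ext c
      simp only [Pi.smul_apply, smul_eq_mul, Pi.sub_apply]
      linear_combination h4 z hz (s j) (t j) c
    rw [this]
    exact Submodule.sum_mem _ fun j _ => Submodule.sub_mem _
        (Submodule.smul_mem _ _ (row_mem_rowSpan W _)) (Submodule.smul_mem _ _ (row_mem_rowSpan W _))

/-- The bivectors of a plane form a line, and the normalization leaves no scalar free. In
coordinates, `smul_eq` for both matrices turns `W a b` times the norm of `W'` into `W' a b` times
the norm of `W`. -/
lemma IsPlucker.eq_of_rowSpan_eq {W W' : κ → κ → R} (hW : IsPlucker s t W)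
    (hW' : IsPlucker s t W') (h : rowSpan W = rowSpan W') : W = W' := by
  ext a b
  have h1 : ∀ j, W a b * W' (s j) (t j) = W' (s j) b * W a (t j) - W' (s j) a * W b (t j) :=
    fun j => congrFun (hW.smul_eq a b (h ▸ row_mem_rowSpan W' (s j))) (t j)
  have h2 : ∀ j, W' a b * W (t j) (s j) = W (t j) b * W' a (s j) - W (t j) a * W' b (s j) :=
    fun j => congrFun (hW'.smul_eq a b (h ▸ row_mem_rowSpan W (t j))) (s j)
  calc W a b = ∑ j, W a b * W' (s j) (t j) := by rw [← Finset.mul_sum, hW'.norm, mul_one]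
    _ = ∑ j, W' a b * W (s j) (t j) := Finset.sum_congr rfl fun j _ => by
      rw [h1, hW.skew (s j), mul_neg, h2, hW.skew (t j) b, hW.skew (t j) a, hW'.skew a (s j),
        hW'.skew b (s j)]
      ring
    _ = W' a b := by rw [← Finset.mul_sum, hW.norm, mul_one]

/-- The plane spanned by `u`, `v` with `pform u v = 1`. -/
lemma isPlucker_wedge {u v : κ → R} (h : pform s t u v = 1) :
    IsPlucker s t fun a b => u a * v b - v a * u b where
  alt a := by ring
  skew a b := by ring
  rel a b c d := by ring
  norm := by
    rw [← h, pform]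
    exact Finset.sum_congr rfl fun j _ => by ring

/-- Plücker coordinates of a plane not contained in a coordinate hyperplane. -/
lemma IsPlucker.exists_wedge [Finite κ] {W : κ → κ → R} (hW : IsPlucker s t W) (f : κ)
    (hf : Ideal.span (Set.range fun c => W c f) = ⊤) :
    ∃ u v : κ → R, u f = 0 ∧ v f = 1 ∧ pform s t u v = 1 ∧ ∀ a b, W a b = u a * v b - v a * u b := by
  have := Fintype.ofFinite κ
  -- The coefficients `e` combine the rows to a vector `v` with `v f = 1`. For `u` serves the column
  -- of `W` at `f`, which represents the coordinate `f` through the form; then `W = u ∧ v` is a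
  -- weighted sum of Plücker relations.
  obtain ⟨e, he⟩ := (Ideal.mem_span_range_iff_exists_fun).1 ((Ideal.eq_top_iff_one _).1 hf)
  have h : ∀ a b, W a b = W a f * (∑ c, e c * W c b) - (∑ c, e c * W c a) * W b f := by
    intro a b
    rw [Finset.mul_sum, Finset.sum_mul, ← Finset.sum_sub_distrib]
    calc W a b = ∑ c, W a b * (e c * W c f) := by rw [← Finset.mul_sum, he, mul_one]
      _ = _ := Finset.sum_congr rfl fun c _ => by
        rw [hW.skew c b, hW.skew c a]
        linear_combination e c * hW.rel a b c f
  refine ⟨fun c => W c f, fun b => ∑ c, e c * W c b, hW.alt f, he, ?_, h⟩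
  rw [← hW.norm, pform]
  exact Finset.sum_congr rfl fun j _ => by rw [h (s j) (t j)]; ring

end Plucker

end QuatProj

end
noncomputable section

namespace QuatProj

/-! ### Plücker coordinates on the strata -/

section HPPoints

variable {R : Type u} [CommRing R]

lemma stdForm_eq_pform (m : ℕ) (x y : Fin m × Fin 2 → R) :
    stdForm R m x y = pform (fun j => (j, 0)) (fun j => (j, 1)) x y := rfl

lemma isPerfPair_of_bijective_of_alternating {M : Type u} [AddCommGroup M] [Module R M]
    (B : M →ₗ[R] M →ₗ[R] R) (hB : ∀ x y, B x y = -B y x) (h : Function.Bijective B) :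
    B.IsPerfPair where
  bijective_left := h
  bijective_right := by
    have : (B.flip : M → M →ₗ[R] R) = B ∘ Neg.neg := by
      ext x y
      simp [hB y x]
    rw [this]
    exact h.comp (Equiv.neg M).bijective

/-- A vector orthogonal to all rows has zero coordinates by `pform_row`, hence injectivity. A
functional is represented by its contraction with `W`, the dual of the expansion `eq_sum`. -/
lemma IsPlucker.mem_hpPoints {n : ℕ} {W : Fin (n + 1) × Fin 2 → Fin (n + 1) × Fin 2 → R}
    (hW : IsPlucker (fun j => (j, 0)) (fun j => (j, 1)) W) : rowSpan W ∈ hpPoints R n := by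
  refine ⟨hW.isSubbundle, isPerfPair_of_bijective_of_alternating _
    (fun x y => pform_swap (fun j => (j, 0)) (fun j => (j, 1)) x.1 y.1) ⟨?_, fun f => ?_⟩⟩
  · rw [injective_iff_map_eq_zero]
    intro x hx
    ext1
    ext a
    rw [← hW.pform_row x.2]
    exact LinearMap.congr_fun hx ⟨W a, row_mem_rowSpan W a⟩
  · let W' (a) : rowSpan W := ⟨W a, row_mem_rowSpan W a⟩
    refine ⟨∑ j, (f (W' (j, 1)) • W' (j, 0) - f (W' (j, 0)) • W' (j, 1)), ?_⟩
    ext x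
    have hx : x = ∑ j, (x.1 (j, 1) • W' (j, 0) - x.1 (j, 0) • W' (j, 1)) := by
      ext1
      simpa [W'] using (hW.eq_sum x.2).symm
    have hr (a) : ((stdForm R (n + 1)).domRestrict₁₂ (rowSpan W) (rowSpan W)) (W' a) x = -x.1 a := by
      rw [← hW.pform_row x.2, ← pform_swap]
      rfl
    conv_rhs => rw [hx]
    simp only [map_sum, map_sub, map_smul, LinearMap.sum_apply, LinearMap.sub_apply,
      LinearMap.smul_apply, hr, smul_eq_mul]
    exact Finset.sum_congr rfl fun j _ => by ring

/-- By nondegeneracy every coordinate functional on `U` is `φ(y, ·)` for some `y` in `U`. If all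
values of the form lay in a maximal ideal `m`, all coordinates would too, so `U = m U`; by Nakayama
`U` would vanish at `m`, against rank `2`. -/
lemma exists_isPlucker_of_mem_hpPoints {n : ℕ} {U : Submodule R (Fin (n + 1) × Fin 2 → R)}
    (hU : U ∈ hpPoints R n) :
    ∃ W, IsPlucker (fun j => (j, 0)) (fun j => (j, 1)) W ∧ rowSpan W = U := by
  refine hU.1.minorsVanish.exists_isPlucker ?_
  by_contra hI
  obtain ⟨m, hm, hle⟩ := Ideal.exists_le_maximal _ hI
  have hfin := hU.1.finite
  have hproj := hU.1.projective
  have hco : ∀ x ∈ U, ∀ a, x a ∈ m := by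
    intro x hx a
    obtain ⟨y, hy⟩ := hU.2.bijective_left.2 (LinearMap.proj a ∘ₗ U.subtype)
    have := LinearMap.congr_fun hy ⟨x, hx⟩
    simp only [LinearMap.domRestrict₁₂_apply, LinearMap.comp_apply, Submodule.subtype_apply,
      LinearMap.proj_apply] at this
    rw [← this]
    exact hle (Ideal.subset_span ⟨y.1, y.2, x, hx, rfl⟩)
  obtain ⟨q, hq⟩ := hU.1.exists_retraction
  have hmU : (⊤ : Submodule R U) ≤ m • ⊤ := by
    intro x _
    rw [← hq x, pi_eq_sum_univ x.1, map_sum]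
    refine Submodule.sum_mem _ fun a _ => ?_
    rw [map_smul]
    exact Submodule.smul_mem_smul (hco x.1 x.2 a) trivial
  obtain ⟨r, hr, hr'⟩ := Submodule.exists_sub_one_mem_and_smul_eq_zero_of_fg_of_le_smul m ⊤
    (Module.Finite.fg_top) hmU
  have hrm : r ∉ m := fun h => hm.ne_top (m.eq_top_iff_one.2 (by simpa using m.sub_mem h hr))
  have := rankAtStalk_eq_of_smul_inverse (M := U) (N := PUnit) ⟨m, hm.isPrime⟩ hrm 0 0
    (fun _ => rfl) (fun x => by simp [hr' x trivial])
  rw [hU.1.rank_eq] at this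
  simp at this

lemma mem_flagEPerp {m i : ℕ} {x : Fin m × Fin 2 → R} :
    x ∈ flagEPerp R m i ↔ ∀ j : Fin m, (j : ℕ) < i → x (j, 1) = 0 := by
  have h (j : Fin m) : stdForm R m (Pi.single (j, 0) 1) x = x (j, 1) := by
    rw [stdForm_eq_pform, pform, Finset.sum_eq_single j]
    · simp
    · intro b _ hb
      simp [hb]
    · simp
  rw [flagEPerp, LinearMap.BilinForm.mem_orthogonal_iff]
  constructor
  · intro hx j hj
    rw [← h j]
    exact hx _ (Submodule.subset_span ⟨j, hj, rfl⟩)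
  · intro hx y hy
    induction hy using Submodule.span_induction with
    | mem y hy =>
      obtain ⟨j, hj, rfl⟩ := hy
      rw [h, hx j hj]
    | zero => simp
    | add y z _ _ hy hz => simp [hy, hz]
    | smul r y _ hy => simp [hy]

lemma rowSpan_le_flagEPerp {m i : ℕ} {W : Fin m × Fin 2 → Fin m × Fin 2 → R} :
    rowSpan W ≤ flagEPerp R m i ↔ ∀ (j : Fin m), (j : ℕ) < i → ∀ a, W a (j, 1) = 0 := by
  rw [rowSpan, Submodule.span_le, Set.range_subset_iff]
  simp only [SetLike.mem_coe, mem_flagEPerp]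
  exact ⟨fun h j hj a => h a j hj, fun h a j hj => h j hj a⟩

lemma mem_closedStratumPoints {n i : ℕ} {U : Submodule R (Fin (n + 1) × Fin 2 → R)} :
    U ∈ closedStratumPoints R n i ↔ ∃ W, IsPlucker (fun j => (j, 0)) (fun j => (j, 1)) W ∧
      (∀ (j : Fin (n + 1)), (j : ℕ) < i → ∀ a, W a (j, 1) = 0) ∧ rowSpan W = U := by
  constructor
  · rintro ⟨h1, h2⟩
    obtain ⟨W, hW, rfl⟩ := exists_isPlucker_of_mem_hpPoints h1
    exact ⟨W, hW, rowSpan_le_flagEPerp.1 h2, rfl⟩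
  · rintro ⟨W, hW, h, rfl⟩
    exact ⟨hW.mem_hpPoints, rowSpan_le_flagEPerp.2 h⟩

/-- A proper ideal dies in the residue field of a maximal ideal containing it. This turns the
condition on field-valued points into an equation over `R`. -/
lemma ideal_eq_top_iff_forall_field {ι : Type} (v : ι → R) :
    Ideal.span (Set.range v) = ⊤ ↔
      ∀ (K : Type u) [Field K] (g : R →+* K), ∃ a, g (v a) ≠ 0 := by
  constructor
  · intro h K _ g
    by_contra! h0
    have : Ideal.span (Set.range v) ≤ RingHom.ker g := Ideal.span_le.2 (by
      rintro _ ⟨a, rfl⟩; exact h0 a)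
    rw [h, top_le_iff] at this
    exact RingHom.ker_ne_top g this
  · intro h
    by_contra hI
    obtain ⟨m, hm, hle⟩ := Ideal.exists_le_maximal _ hI
    let := Ideal.Quotient.field m
    obtain ⟨a, ha⟩ := h (R ⧸ m) (Ideal.Quotient.mk m)
    exact ha (Ideal.Quotient.eq_zero_iff_mem.2 (hle (Ideal.subset_span ⟨a, rfl⟩)))

/-- At a field-valued point the fibre lies in `E_{i+1}^⊥` exactly when the entries `W a f_{i+1}` all
vanish there. Hyperbolic planes are numbered from `0`, so `f_{i+1}` has index `(i, 1)`. -/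
lemma mem_stratumPoints {n i : ℕ} (hi : i ≤ n) {U : Submodule R (Fin (n + 1) × Fin 2 → R)} :
    U ∈ stratumPoints R n i ↔ ∃ W, IsPlucker (fun j => (j, 0)) (fun j => (j, 1)) W ∧
      (∀ (j : Fin (n + 1)), (j : ℕ) < i → ∀ a, W a (j, 1) = 0) ∧
      Ideal.span (Set.range fun a => W a (⟨i, by omega⟩, 1)) = ⊤ ∧ rowSpan W = U := by
  rw [stratumPoints, Set.mem_ofPred_eq, mem_closedStratumPoints]
  constructor
  · rintro ⟨⟨W, hW, h, rfl⟩, h2⟩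
    refine ⟨W, hW, h, (ideal_eq_top_iff_forall_field _).2 fun K _ g => ?_, rfl⟩
    by_contra! h0
    refine h2 K g (mem_closedStratumPoints.2 ⟨_, hW.map g, fun j hj a => ?_,
      (pullbackSub_rowSpan g W).symm⟩)
    obtain hj | hj := Nat.lt_succ_iff_lt_or_eq.1 hj
    · rw [h j hj, map_zero]
    · rw [show j = ⟨i, by omega⟩ from Fin.ext hj, h0]
  · rintro ⟨W, hW, h, h2, rfl⟩
    refine ⟨⟨W, hW, h, rfl⟩, fun K _ g hg => ?_⟩
    obtain ⟨a, ha⟩ := (ideal_eq_top_iff_forall_field _).1 h2 K g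
    rw [pullbackSub_rowSpan] at hg
    exact ha (rowSpan_le_flagEPerp.1 hg.2 _ (Nat.lt_succ_self i) a)

end HPPoints

/-! ### Coordinates of `E_i^⊥` among all coordinates. -/

section StratumIndex

variable {R : Type u} [CommRing R]

/-- Every term of a Plücker relation involves all four indices, so the relation is trivial once one
of them is outside the image. Only the normalization depends on `s'` and `t'`. -/
lemma IsPlucker.extend {κ κ' J J' : Type} [Fintype J] [Fintype J'] {s t : J → κ} {s' t' : J' → κ'}
    {W : κ → κ → R} (hW : IsPlucker s t W) {f : κ → κ'} (hf : Function.Injective f)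
    (hn : ∑ j, Function.extend f (fun a => Function.extend f (W a) 0) 0 (s' j) (t' j)
      = ∑ j, W (s j) (t j)) :
    IsPlucker s' t' (Function.extend f (fun a => Function.extend f (W a) 0) 0) := by
  set V := Function.extend f (fun a => Function.extend f (W a) 0) 0 with hV
  have h1 (a b) : V (f a) (f b) = W a b := by rw [hV, hf.extend_apply, hf.extend_apply]
  have h2 (p q) (hp : ¬ ∃ a, f a = p) : V p q = 0 := by
    rw [hV, Function.extend_apply' _ _ _ hp]; rfl
  have h3 (p q) (hq : ¬ ∃ a, f a = q) : V p q = 0 := by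
    by_cases hp : ∃ a, f a = p
    · obtain ⟨a, rfl⟩ := hp
      rw [hV, hf.extend_apply, Function.extend_apply' _ _ _ hq]; rfl
    · exact h2 _ _ hp
  refine ⟨fun p => ?_, fun p q => ?_, fun p q r s => ?_, hn.trans hW.norm⟩
  · by_cases hp : ∃ a, f a = p
    · obtain ⟨a, rfl⟩ := hp
      rw [h1, hW.alt]
    · exact h2 _ _ hp
  · by_cases hp : ∃ a, f a = p
    · by_cases hq : ∃ a, f a = q
      · obtain ⟨a, rfl⟩ := hp
        obtain ⟨b, rfl⟩ := hq
        rw [h1, h1, hW.skew]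
      · rw [h3 _ _ hq, h2 _ _ hq, neg_zero]
    · rw [h3 _ _ hp, h2 _ _ hp, neg_zero]
  · by_cases hp : ∃ a, f a = p
    swap; · simp [h2 _ _ hp]
    by_cases hq : ∃ a, f a = q
    swap; · simp [h2 _ _ hq, h3 _ _ hq]
    by_cases hr : ∃ a, f a = r
    swap; · simp [h2 _ _ hr, h3 _ _ hr]
    by_cases hs : ∃ a, f a = s
    swap; · simp [h3 _ _ hs]
    obtain ⟨a, rfl⟩ := hp
    obtain ⟨b, rfl⟩ := hq
    obtain ⟨c, rfl⟩ := hr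
    obtain ⟨d, rfl⟩ := hs
    simp only [h1, hW.rel]

/-- The coordinates of `E_i^⊥`: `e_j` for `j ≤ i`, and all `e_j`, `f_j` for `j > i`, where the
index `none` stands for the hyperbolic plane `⟨e_{i+1}, f_{i+1}⟩`. -/
abbrev PerpIdx (n i : ℕ) : Type := Fin i ⊕ (Option (Fin (n - i)) × Fin 2)

/-- The index of `e_j`. -/
abbrev perpSrc (n i : ℕ) (j : Option (Fin (n - i))) : PerpIdx n i := .inr (j, 0)

/-- The index of `f_j`. -/
abbrev perpTgt (n i : ℕ) (j : Option (Fin (n - i))) : PerpIdx n i := .inr (j, 1)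

variable {n i : ℕ} (hi : i ≤ n)

/-- The position of a hyperbolic plane among all of them. -/
def posEquiv : Fin i ⊕ Option (Fin (n - i)) ≃ Fin (n + 1) :=
  ((Equiv.refl _).sumCongr (finSuccEquiv (n - i)).symm).trans
    (finSumFinEquiv.trans (finCongr (by omega)))

lemma posEquiv_inl (j : Fin i) : (posEquiv hi (.inl j) : ℕ) = j := by
  simp [posEquiv]

lemma posEquiv_inr (j : Option (Fin (n - i))) : i ≤ (posEquiv hi (.inr j) : ℕ) := by
  simp [posEquiv]

lemma posEquiv_none : posEquiv hi (.inr none) = ⟨i, by omega⟩ := by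
  ext
  simp [posEquiv]

/-- The inclusion of the coordinates of `E_i^⊥` in all coordinates. -/
def perpEmb : PerpIdx n i → Fin (n + 1) × Fin 2 :=
  Sum.elim (fun j => (posEquiv hi (.inl j), 0)) fun p => (posEquiv hi (.inr p.1), p.2)

lemma perpEmb_injective : Function.Injective (perpEmb hi) := by
  rintro (a | ⟨a, b⟩) (c | ⟨c, d⟩) h <;> simp_all [perpEmb]

lemma notMem_range_perpEmb {p : Fin (n + 1) × Fin 2} :
    (¬ ∃ a, perpEmb hi a = p) ↔ (p.1 : ℕ) < i ∧ p.2 = 1 := by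
  obtain ⟨p, e⟩ := p
  obtain ⟨(j | j), rfl⟩ := (posEquiv hi).surjective p
  · have h1 : (posEquiv hi (.inl j) : ℕ) < i := by rw [posEquiv_inl]; exact j.2
    fin_cases e
    · simp [perpEmb]
    · simp [perpEmb, h1]
  · have := posEquiv_inr hi j
    refine iff_of_false (not_not.2 ⟨.inr (j, e), rfl⟩) fun h => ?_
    exact absurd h.1 (by simpa using this)

/-- Extension of Plücker coordinates by zero. -/
def perpExt (W : PerpIdx n i → PerpIdx n i → R) : Fin (n + 1) × Fin 2 → Fin (n + 1) × Fin 2 → R :=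
  Function.extend (perpEmb hi) (fun a => Function.extend (perpEmb hi) (W a) 0) 0

lemma perpExt_perpEmb (W : PerpIdx n i → PerpIdx n i → R) (a b : PerpIdx n i) :
    perpExt hi W (perpEmb hi a) (perpEmb hi b) = W a b := by
  rw [perpExt, (perpEmb_injective hi).extend_apply, (perpEmb_injective hi).extend_apply]

lemma perpExt_injective : Function.Injective (perpExt (R := R) hi) := by
  intro W W' h
  ext a b
  rw [← perpExt_perpEmb hi W, h, perpExt_perpEmb]

lemma perpExt_right_eq_zero (W : PerpIdx n i → PerpIdx n i → R) (p) {q : Fin (n + 1) × Fin 2}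
    (hq : ¬ ∃ a, perpEmb hi a = q) : perpExt hi W p q = 0 := by
  by_cases hp : ∃ a, perpEmb hi a = p
  · obtain ⟨a, rfl⟩ := hp
    rw [perpExt, (perpEmb_injective hi).extend_apply, Function.extend_apply' _ _ _ hq]; rfl
  · rw [perpExt, Function.extend_apply' _ _ _ hp]; rfl

lemma perpExt_left_eq_zero (W : PerpIdx n i → PerpIdx n i → R) {p} (q : Fin (n + 1) × Fin 2)
    (hp : ¬ ∃ a, perpEmb hi a = p) : perpExt hi W p q = 0 := by
  rw [perpExt, Function.extend_apply' _ _ _ hp]; rfl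

lemma perpExt_map {R' : Type u} [CommRing R'] (g : R →+* R') (W : PerpIdx n i → PerpIdx n i → R) :
    (fun p q => g (perpExt hi W p q)) = perpExt hi fun a b => g (W a b) := by
  ext p q
  by_cases hp : ∃ a, perpEmb hi a = p
  · by_cases hq : ∃ a, perpEmb hi a = q
    · obtain ⟨a, rfl⟩ := hp
      obtain ⟨b, rfl⟩ := hq
      simp only [perpExt_perpEmb]
    · simp only [perpExt_right_eq_zero _ _ _ hq, map_zero]
  · simp only [perpExt_left_eq_zero _ _ _ hp, map_zero]

lemma IsPlucker.perpExt {W : PerpIdx n i → PerpIdx n i → R}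
    (hW : IsPlucker (perpSrc n i) (perpTgt n i) W) :
    IsPlucker (fun j => (j, 0)) (fun j => (j, 1)) (perpExt hi W) := by
  refine hW.extend (perpEmb_injective hi) ?_
  rw [← (posEquiv hi).sum_comp, Fintype.sum_sum_type, Finset.sum_eq_zero, zero_add]
  · exact Finset.sum_congr rfl fun j _ =>
      perpExt_perpEmb hi W (perpSrc n i j) (perpTgt n i j)
  · intro j _
    refine perpExt_right_eq_zero hi W _ ((notMem_range_perpEmb hi).2 ⟨?_, rfl⟩)
    simp [posEquiv_inl]

/-- The rows added by extension are zero and contribute nothing to the ideal. -/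
lemma span_range_perpExt (W : PerpIdx n i → PerpIdx n i → R) :
    Ideal.span (Set.range fun p => perpExt hi W p (⟨i, by omega⟩, 1)) =
      Ideal.span (Set.range fun a => W a (.inr (none, 1))) := by
  have h : ((⟨i, by omega⟩, 1) : Fin (n + 1) × Fin 2) = perpEmb hi (.inr (none, 1)) := by
    simp [perpEmb, posEquiv_none]
  rw [h]
  refine le_antisymm (Ideal.span_le.2 ?_) (Ideal.span_mono ?_)
  · rintro _ ⟨p, rfl⟩
    dsimp only
    by_cases hp : ∃ a, perpEmb hi a = p
    · obtain ⟨a, rfl⟩ := hp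
      rw [perpExt_perpEmb]
      exact Ideal.subset_span ⟨a, rfl⟩
    · rw [perpExt_left_eq_zero _ _ _ hp]
      exact Ideal.zero_mem _
  · rintro _ ⟨a, rfl⟩
    exact ⟨perpEmb hi a, perpExt_perpEmb _ _ _ _⟩

lemma IsPlucker.mem_stratumPoints {W : PerpIdx n i → PerpIdx n i → R}
    (hW : IsPlucker (perpSrc n i) (perpTgt n i) W)
    (h : Ideal.span (Set.range fun a => W a (.inr (none, 1))) = ⊤) :
    rowSpan (QuatProj.perpExt hi W) ∈ stratumPoints R n i :=
  (QuatProj.mem_stratumPoints hi).2 ⟨_, hW.perpExt hi, fun _ hj _ => perpExt_right_eq_zero hi W _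
    ((notMem_range_perpEmb hi).2 ⟨hj, rfl⟩), (span_range_perpExt hi W).trans h, rfl⟩

lemma exists_isPlucker_of_mem_stratumPoints {U : Submodule R (Fin (n + 1) × Fin 2 → R)}
    (hU : U ∈ stratumPoints R n i) :
    ∃ W, IsPlucker (perpSrc n i) (perpTgt n i) W ∧
      Ideal.span (Set.range fun a => W a (.inr (none, 1))) = ⊤ ∧ rowSpan (perpExt hi W) = U := by
  obtain ⟨V, hV, h1, h2, rfl⟩ := (mem_stratumPoints hi).1 hU
  have hz (p q) (hq : ¬ ∃ a, perpEmb hi a = q) : V p q = 0 := by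
    rw [notMem_range_perpEmb] at hq
    obtain ⟨q, e⟩ := q
    obtain ⟨hq, rfl⟩ := hq
    exact h1 q hq p
  have he : perpExt hi (fun a b => V (perpEmb hi a) (perpEmb hi b)) = V := by
    ext p q
    by_cases hp : ∃ a, perpEmb hi a = p
    · by_cases hq : ∃ a, perpEmb hi a = q
      · obtain ⟨a, rfl⟩ := hp
        obtain ⟨b, rfl⟩ := hq
        rw [perpExt_perpEmb]
      · rw [perpExt_right_eq_zero _ _ _ hq, hz _ _ hq]
    · rw [perpExt_left_eq_zero _ _ _ hp, hV.skew, hz _ _ hp, neg_zero]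
  refine ⟨fun a b => V (perpEmb hi a) (perpEmb hi b), ⟨fun a => hV.alt _, fun a b => hV.skew _ _,
    fun a b c d => hV.rel _ _ _ _, ?_⟩, ?_, by rw [he]⟩
  · have h3 : ∑ j, V (posEquiv hi (.inl j), 0) (posEquiv hi (.inl j), 1) = 0 :=
      Finset.sum_eq_zero fun j _ => hz _ _ ((notMem_range_perpEmb hi).2
        ⟨by simp [posEquiv_inl], rfl⟩)
    rw [← hV.norm, ← (posEquiv hi).sum_comp, Fintype.sum_sum_type, h3, zero_add]
    rfl
  · rw [← h2, ← he, span_range_perpExt hi, he]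

end StratumIndex

/-! ### The coordinates of the affine space covering a stratum -/

section Cell

variable {R : Type u} [CommRing R] {n i : ℕ}

/-- The vector `u = (α, 1 - φ(a, b), 0, a)` of the symplectic basis `u`, `v` attached to a point. -/
def cellU (x : CellIdx.{u} n i → R) : PerpIdx n i → R
  | .inl j => x ⟨.inl j⟩
  | .inr (some j, e) => x ⟨.inr (.inl (j, e))⟩
  | .inr (none, 0) => 1 - stdForm R (n - i) (fun j => x ⟨.inr (.inl j)⟩)
      (fun j => x ⟨.inr (.inr (.inr (.inl j)))⟩)
  | .inr (none, 1) => 0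

/-- The vector `v = (β, r, 1, b)` of the symplectic basis `u`, `v` attached to a point. -/
def cellV (x : CellIdx.{u} n i → R) : PerpIdx n i → R
  | .inl j => x ⟨.inr (.inr (.inl j))⟩
  | .inr (some j, e) => x ⟨.inr (.inr (.inr (.inl (j, e))))⟩
  | .inr (none, 0) => x ⟨.inr (.inr (.inr (.inr ())))⟩
  | .inr (none, 1) => 1

lemma pform_perp (u v : PerpIdx n i → R) : pform (perpSrc n i) (perpTgt n i) u v =
    (u (.inr (none, 0)) * v (.inr (none, 1)) - u (.inr (none, 1)) * v (.inr (none, 0))) +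
      stdForm R (n - i) (fun j => u (.inr (some j.1, j.2))) (fun j => v (.inr (some j.1, j.2))) := by
  rw [pform, Fintype.sum_option]
  rfl

lemma pform_cell (x : CellIdx.{u} n i → R) :
    pform (perpSrc n i) (perpTgt n i) (cellU x) (cellV x) = 1 := by
  rw [pform_perp]
  simp [cellU, cellV]

/-- With `u_f = 0` and `v_f = 1`, the equation `φ(u, v) = 1` reads `u_e + φ(a, b) = 1`. It fixes
`u_e` and leaves the other coordinates free, which is why the parameter space is an affine space. -/
lemma cell_surjective {u v : PerpIdx n i → R} (h0 : u (.inr (none, 1)) = 0)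
    (h1 : v (.inr (none, 1)) = 1) (h : pform (perpSrc n i) (perpTgt n i) u v = 1) :
    ∃ x : CellIdx.{u} n i → R, cellU x = u ∧ cellV x = v := by
  refine ⟨fun c => match c with
    | ⟨.inl j⟩ => u (.inl j)
    | ⟨.inr (.inl j)⟩ => u (.inr (some j.1, j.2))
    | ⟨.inr (.inr (.inl j))⟩ => v (.inl j)
    | ⟨.inr (.inr (.inr (.inl j)))⟩ => v (.inr (some j.1, j.2))
    | ⟨.inr (.inr (.inr (.inr ())))⟩ => v (.inr (none, 0)), ?_, ?_⟩
  · rw [pform_perp, h0, h1] at h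
    ext (j | ⟨_ | j, e⟩)
    · rfl
    · fin_cases e
      · change 1 - stdForm R (n - i) _ _ = u (.inr (none, 0))
        linear_combination -h
      · exact h0.symm
    · rfl
  · ext (j | ⟨_ | j, e⟩)
    · rfl
    · fin_cases e
      · rfl
      · exact h1.symm
    · rfl

lemma cell_ext {x y : CellIdx.{u} n i → R} (hu : cellU x = cellU y) (hv : cellV x = cellV y) :
    x = y := by
  ext ⟨j | j | j | j | j⟩
  · exact congrFun hu (.inl j)
  · exact congrFun hu (.inr (some j.1, j.2))
  · exact congrFun hv (.inl j)
  · exact congrFun hv (.inr (some j.1, j.2))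
  · exact congrFun hv (.inr (none, 0))

/-- Since `φ(a, b + t a) = φ(a, b)`, the action fixes `u`. Together with `cellV_cellFormula` it
becomes `(u, v) ↦ (u, v + t u)`, from which the action laws are evident. -/
lemma cellU_cellFormula (t : R) (x : CellIdx.{u} n i → R) :
    cellU (cellFormula n i t x) = cellU x := by
  ext (j | ⟨_ | j, e⟩)
  · rfl
  · fin_cases e
    · simp only [cellU, cellFormula]
      have : (fun j : Fin (n - i) × Fin 2 => x ⟨.inr (.inr (.inr (.inl j)))⟩ +
          t * x ⟨.inr (.inl j)⟩) = (fun j => x ⟨.inr (.inr (.inr (.inl j)))⟩) +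
          t • fun j => x ⟨.inr (.inl j)⟩ := rfl
      simp only [this, map_add, map_smul, stdForm_eq_pform, pform_self, smul_zero, add_zero]
    · rfl
  · rfl

lemma cellV_cellFormula (t : R) (x : CellIdx.{u} n i → R) :
    cellV (cellFormula n i t x) = cellV x + t • cellU x := by
  ext (j | ⟨_ | j, e⟩)
  · rfl
  · fin_cases e
    · rfl
    · simp [cellU, cellV]
  · rfl

lemma cellFormula_zero (x : CellIdx.{u} n i → R) : cellFormula n i 0 x = x :=
  cell_ext (cellU_cellFormula _ _) (by simp [cellV_cellFormula])

lemma cellFormula_add (s t : R) (x : CellIdx.{u} n i → R) :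
    cellFormula n i (s + t) x = cellFormula n i s (cellFormula n i t x) :=
  cell_ext (by simp only [cellU_cellFormula])
    (by simp only [cellV_cellFormula, cellU_cellFormula]; module)

/-- A fixed point gives `t u = 0`; pairing with `v` gives `t = 0`. -/
lemma cellFormula_eq_self {t : R} {x : CellIdx.{u} n i → R} (h : cellFormula n i t x = x) :
    t = 0 := by
  have h1 := congrArg cellV h
  rw [cellV_cellFormula, add_eq_left] at h1
  rw [← mul_one t, ← pform_cell x, ← pform_smul_left, h1, pform_zero_left]

/-- The Plücker coordinates of the plane spanned by `u` and `v`. -/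
def cellW (x : CellIdx.{u} n i → R) (a b : PerpIdx n i) : R :=
  cellU x a * cellV x b - cellV x a * cellU x b

lemma isPlucker_cellW (x : CellIdx.{u} n i → R) :
    IsPlucker (perpSrc n i) (perpTgt n i) (cellW x) :=
  isPlucker_wedge (pform_cell x)

/-- The plane thus determines `u`; only `v` remains ambiguous. -/
lemma cellW_right (x : CellIdx.{u} n i → R) (a : PerpIdx n i) :
    cellW x a (.inr (none, 1)) = cellU x a := by
  simp [cellW, cellU, cellV]

lemma sum_cellU (x : CellIdx.{u} n i → R) :
    Ideal.span (Set.range (cellU x)) = ⊤ := by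
  rw [Ideal.eq_top_iff_one, ← pform_cell x]
  refine Ideal.sum_mem _ fun j _ => Ideal.sub_mem _ (Ideal.mul_mem_right _ _ ?_)
    (Ideal.mul_mem_right _ _ ?_) <;> exact Ideal.subset_span ⟨_, rfl⟩

lemma cellW_cellFormula (t : R) (x : CellIdx.{u} n i → R) :
    cellW (cellFormula n i t x) = cellW x := by
  ext a b
  simp only [cellW, cellU_cellFormula, cellV_cellFormula, Pi.add_apply, Pi.smul_apply, smul_eq_mul]
  ring

/-- Two points with the same plane differ by the action of `φ(v_y, v_x)`. -/
lemma eq_cellFormula_of_cellW_eq {x y : CellIdx.{u} n i → R} (h : cellW x = cellW y) :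
    y = cellFormula n i (pform (perpSrc n i) (perpTgt n i) (cellV y) (cellV x)) x := by
  have hu : cellU x = cellU y := by
    ext a
    rw [← cellW_right, h, cellW_right]
  refine cell_ext (by rw [cellU_cellFormula, hu]) ?_
  rw [cellV_cellFormula]
  ext b
  have h1 (a) : cellU x a * cellV x b - cellV x a * cellU x b
      = cellU x a * cellV y b - cellV y a * cellU x b := by
    have := congrFun (congrFun h a) b
    rwa [cellW, cellW, ← hu] at this
  -- With common `u`, and `v`, `v'` belonging to `x`, `y`, the identity `h1` reads `v'_b u = v_b u +
  -- u_b v' - u_b v`. Pairing it with `v`, where `φ(u, v) = 1`, gives `v'_b = v_b + φ(v', v) u_b`.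
  have h2 : pform (perpSrc n i) (perpTgt n i) (cellV y b • cellU x) (cellV x) =
      pform (perpSrc n i) (perpTgt n i) (cellV x b • cellU x + cellU x b • cellV y -
        cellU x b • cellV x) (cellV x) := by
    congr 1
    ext a
    simp only [Pi.add_apply, Pi.smul_apply, Pi.sub_apply, smul_eq_mul]
    linear_combination - h1 a
  rw [sub_eq_add_neg, ← neg_smul, pform_add_left, pform_add_left, pform_smul_left, pform_smul_left,
    pform_smul_left, pform_smul_left, pform_cell, pform_self] at h2
  simp only [Pi.add_apply, Pi.smul_apply, smul_eq_mul]
  linear_combination h2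

lemma exists_cellW_eq {W : PerpIdx n i → PerpIdx n i → R}
    (hW : IsPlucker (perpSrc n i) (perpTgt n i) W)
    (h : Ideal.span (Set.range fun a => W a (.inr (none, 1))) = ⊤) :
    ∃ x : CellIdx.{u} n i → R, cellW x = W := by
  obtain ⟨u, v, h0, h1, h2, h3⟩ := hW.exists_wedge _ h
  obtain ⟨x, rfl, rfl⟩ := cell_surjective h0 h1 h2
  exact ⟨x, funext₂ fun a b => (h3 a b).symm⟩

end Cell

section CellMap

variable {R R' : Type u} [CommRing R] [CommRing R'] (g : R →+* R') {n i : ℕ}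

lemma stdForm_map (m : ℕ) (x y : Fin m × Fin 2 → R) :
    stdForm R' m (fun j => g (x j)) (fun j => g (y j)) = g (stdForm R m x y) :=
  pform_map (fun j => (j, 0)) (fun j => (j, 1)) g x y

lemma cellU_map (x : CellIdx.{u} n i → R) :
    cellU (fun c => g (x c)) = fun a => g (cellU x a) := by
  ext (j | ⟨_ | j, e⟩)
  · rfl
  · fin_cases e
    · simp [cellU, ← stdForm_map]
    · simp [cellU]
  · rfl

lemma cellV_map (x : CellIdx.{u} n i → R) :
    cellV (fun c => g (x c)) = fun a => g (cellV x a) := by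
  ext (j | ⟨_ | j, e⟩)
  · rfl
  · fin_cases e
    · rfl
    · simp [cellV]
  · rfl

lemma cellW_map (x : CellIdx.{u} n i → R) :
    cellW (fun c => g (x c)) = fun a b => g (cellW x a b) := by
  ext a b
  simp [cellW, cellU_map, cellV_map]

lemma cellFormula_map (t : R) (x : CellIdx.{u} n i → R) :
    cellFormula n i (g t) (fun c => g (x c)) = fun c => g (cellFormula n i t x c) :=
  cell_ext (by rw [cellU_cellFormula, cellU_map, cellU_map, cellU_cellFormula])
    (by
      rw [cellV_cellFormula, cellU_map, cellV_map, cellV_map, cellV_cellFormula]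
      ext a
      simp)

end CellMap

end QuatProj

end
noncomputable section

namespace QuatProj

/-! ### Morphisms determined by their effect on affine points -/

section AffinePoints

lemma hom_ext_affine {X Y : Scheme.{u}} {f g : X ⟶ Y}
    (h : ∀ {R : CommRingCat.{u}} (y : Spec R ⟶ X), y ≫ f = y ≫ g) : f = g :=
  X.affineCover.hom_ext f g fun j => h (R := X.affineOpenCover.X j) (X.affineCover.f j)

/-- A natural transformation between the functors of points on affine schemes is induced by a
morphism of schemes. -/
lemma exists_hom_of_affine_points {X Y : Scheme.{u}}
    (η : ∀ {R : CommRingCat.{u}}, (Spec R ⟶ X) → (Spec R ⟶ Y))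
    (hη : ∀ {R R' : CommRingCat.{u}} (g : R ⟶ R') (y : Spec R ⟶ X),
      η (Spec.map g ≫ y) = Spec.map g ≫ η y) :
    ∃ f : X ⟶ Y, ∀ {R : CommRingCat.{u}} (y : Spec R ⟶ X), y ≫ f = η y := by
  -- Intersections of affine charts need not be affine, so compatibility over an arbitrary `T` is
  -- tested on the affine points of `T`.
  have key {R R' : CommRingCat.{u}} (y : Spec R ⟶ X) (y' : Spec R' ⟶ X) {T : Scheme.{u}}
      (a : T ⟶ Spec R) (b : T ⟶ Spec R') (h : a ≫ y = b ≫ y') : a ≫ η y = b ≫ η y' := by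
    refine hom_ext_affine fun z => ?_
    obtain ⟨a', ha⟩ := Spec.map_surjective (z ≫ a)
    obtain ⟨b', hb⟩ := Spec.map_surjective (z ≫ b)
    rw [← Category.assoc, ← Category.assoc, ← ha, ← hb, ← hη, ← hη, ha, hb, Category.assoc, h,
      Category.assoc]
  let 𝒰 := X.affineOpenCover
  let f : X ⟶ Y := 𝒰.openCover.glueMorphisms (fun j => η (R := 𝒰.X j) (𝒰.f j)) fun i j =>
    key (R := 𝒰.X i) (R' := 𝒰.X j) (𝒰.f i) (𝒰.f j) _ _ pullback.condition
  have hf (j) : 𝒰.f j ≫ f = η (R := 𝒰.X j) (𝒰.f j) := 𝒰.openCover.ι_glueMorphisms _ _ j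
  refine ⟨f, fun {R} y => Scheme.Cover.hom_ext (𝒰.openCover.pullback₁ y) _ _ ?_⟩
  have (j : 𝒰.I₀) : pullback.fst y (𝒰.f j) ≫ y ≫ f = pullback.fst y (𝒰.f j) ≫ η y := by
    rw [pullback.condition_assoc, hf]
    exact key (R := 𝒰.X j) _ _ _ _ pullback.condition.symm
  exact this

/-- The stratum is unique up to isomorphism. -/
lemma IsStratum.nonempty_iso {k : Scheme.{u}} {n i : ℕ} {X Y : Over k} (hX : IsStratum n i X)
    (hY : IsStratum n i Y) : Nonempty (X ≅ Y) := by
  have key : ∀ {X Y : Over k} (hX : IsStratum n i X) (hY : IsStratum n i Y), ∃ f : X ⟶ Y,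
      ∀ {R : CommRingCat.{u}} (y : Spec R ⟶ X.left), hY.taut (y ≫ f.left) = hX.taut y := by
    intro X Y hX hY
    choose η hη hη' using fun {R : CommRingCat.{u}} (y : Spec R ⟶ X.left) =>
      hY.existsUnique (y ≫ X.hom) (hX.taut y) (hX.taut_mem y)
    obtain ⟨f, hf⟩ := exists_hom_of_affine_points η fun g y => by
      refine (hη' _ _ ⟨?_, ?_⟩).symm
      · rw [Category.assoc, (hη y).1, Category.assoc]
      · rw [hY.taut_comp, (hη y).2, hX.taut_comp]
    refine ⟨Over.homMk f (hom_ext_affine fun y => ?_), fun y => ?_⟩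
    · rw [← Category.assoc, hf, (hη y).1]
    · simp only [Over.homMk_left, hf, (hη y).2]
  have key' : ∀ {X : Over k} (hX : IsStratum n i X) (f : X ⟶ X),
      (∀ {R : CommRingCat.{u}} (y : Spec R ⟶ X.left), hX.taut (y ≫ f.left) = hX.taut y) →
      f = 𝟙 X := by
    intro X hX f hf
    ext1
    refine hom_ext_affine fun y => ?_
    obtain ⟨_, _, h⟩ := hX.existsUnique (y ≫ X.hom) _ (hX.taut_mem y)
    rw [h (y ≫ f.left) ⟨by simp, hf y⟩, h (y ≫ Over.Hom.left (𝟙 X)) ⟨by simp, by simp⟩]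
  obtain ⟨f, hf⟩ := key hX hY
  obtain ⟨g, hg⟩ := key hY hX
  refine ⟨⟨f, g, key' hX _ fun y => ?_, key' hY _ fun y => ?_⟩⟩
  · rw [Over.comp_left, ← Category.assoc, hg, hf]
  · rw [Over.comp_left, ← Category.assoc, hf, hg]

end AffinePoints

/-! ### The scheme of Plücker coordinates -/

section PluckerScheme

variable {κ J : Type} [Fintype J] (s t : J → κ)

/-- The polynomial ring in the entries of a matrix. -/
abbrev MatPoly (κ : Type) : Type u := MvPolynomial (κ × κ) (ULift.{u} ℤ)

/-- The equations for Plücker coordinates. -/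
def pluckerRel : Set (MatPoly.{u} κ) :=
  {p | (∃ a, p = .X (a, a)) ∨ (∃ a b, p = .X (a, b) + .X (b, a)) ∨
    (∃ a b c d, p = .X (a, b) * .X (c, d) - .X (a, c) * .X (b, d) + .X (a, d) * .X (b, c)) ∨
    p = ∑ j, .X (s j, t j) - 1}

lemma isPlucker_iff_forall_rel {R : Type u} [CommRing R] (f : MatPoly.{u} κ →+* R) :
    IsPlucker s t (fun a b => f (.X (a, b))) ↔ ∀ p ∈ pluckerRel s t, f p = 0 := by
  constructor
  · rintro h p (⟨a, rfl⟩ | ⟨a, b, rfl⟩ | ⟨a, b, c, d, rfl⟩ | rfl)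
    · exact h.alt a
    · rw [map_add, h.skew a b, neg_add_cancel]
    · simpa using h.rel a b c d
    · rw [map_sub, map_sum, h.norm, map_one, sub_self]
  · intro h
    refine ⟨fun a => h _ (.inl ⟨a, rfl⟩), fun a b => ?_, fun a b c d => ?_, ?_⟩
    · rw [← add_eq_zero_iff_eq_neg, ← map_add]
      exact h _ (.inr (.inl ⟨a, b, rfl⟩))
    · simpa using h _ (.inr (.inr (.inl ⟨a, b, c, d, rfl⟩)))
    · simpa [sub_eq_zero] using h _ (.inr (.inr (.inr rfl)))

/-- The ring representing Plücker coordinates. -/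
abbrev PluckerRing : Type u := MatPoly.{u} κ ⧸ Ideal.span (pluckerRel.{u} s t)

/-- The universal Plücker coordinates. -/
def pluckerGen (a b : κ) : PluckerRing.{u} s t := Ideal.Quotient.mk _ (.X (a, b))

lemma isPlucker_pluckerGen : IsPlucker s t (pluckerGen.{u} s t) := by
  have h : ∀ p ∈ pluckerRel.{u} s t, Ideal.Quotient.mk (Ideal.span (pluckerRel.{u} s t)) p = 0 :=
    fun _ hp => Ideal.Quotient.eq_zero_iff_mem.2 (Ideal.subset_span hp)
  exact (isPlucker_iff_forall_rel s t _).2 h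

/-- Evaluation of a polynomial at a matrix. -/
def evalMat {R : Type u} [CommRing R] (W : κ → κ → R) : MatPoly.{u} κ →+* R :=
  MvPolynomial.eval₂Hom ((Int.castRingHom R).comp ULift.ringEquiv.toRingHom) fun p => W p.1 p.2

lemma evalMat_X {R : Type u} [CommRing R] (W : κ → κ → R) (a b : κ) :
    evalMat W (.X (a, b)) = W a b :=
  MvPolynomial.eval₂_X _ _ _

lemma span_pluckerRel_le_ker {R : Type u} [CommRing R] {W : κ → κ → R} (hW : IsPlucker s t W) :
    Ideal.span (pluckerRel.{u} s t) ≤ RingHom.ker (evalMat.{u} W) := by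
  refine Ideal.span_le.2 ((isPlucker_iff_forall_rel s t (evalMat W)).1 ?_)
  simpa only [evalMat_X] using hW

variable {s t}

/-- The ring homomorphism classifying Plücker coordinates. -/
def pluckerLift {R : Type u} [CommRing R] {W : κ → κ → R} (hW : IsPlucker s t W) :
    PluckerRing.{u} s t →+* R :=
  Ideal.Quotient.lift _ (evalMat W) (span_pluckerRel_le_ker s t hW)

lemma pluckerLift_gen {R : Type u} [CommRing R] {W : κ → κ → R} (hW : IsPlucker s t W) (a b : κ) :
    pluckerLift hW (pluckerGen.{u} s t a b) = W a b :=
  evalMat_X W a b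

lemma pluckerRing_hom_ext {R : Type u} [CommRing R] {f g : PluckerRing.{u} s t →+* R}
    (h : ∀ a b, f (pluckerGen s t a b) = g (pluckerGen s t a b)) : f = g := by
  apply Ideal.Quotient.ringHom_ext
  apply MvPolynomial.ringHom_ext'
  · have : ∀ f g : ULift.{u} ℤ →+* R, f = g := fun f g => by
      have := RingHom.ext_int (f.comp ULift.ringEquiv.symm.toRingHom)
        (g.comp ULift.ringEquiv.symm.toRingHom)
      ext ⟨x⟩
      exact RingHom.congr_fun this x
    exact this _ _
  · rintro ⟨a, b⟩
    exact h a b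

variable (s t)

/-- The spectrum of the ring of Plücker coordinates. -/
abbrev pluckerSpec : Scheme.{u} := Spec (CommRingCat.of (PluckerRing.{u} s t))

/-- The `k`-scheme of Plücker coordinates. -/
def pluckerScheme (k : Scheme.{u}) : Over k :=
  Over.mk (pullback.fst (terminal.from k) (terminal.from (pluckerSpec.{u} s t)))

/-- The projection to the absolute scheme of Plücker coordinates. -/
def toPluckerSpec (k : Scheme.{u}) : (pluckerScheme.{u} s t k).left ⟶ pluckerSpec.{u} s t :=
  pullback.snd _ _

variable {s t}

/-- The Plücker coordinates of a point of `pluckerSpec`. -/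
def specCoords {T : Scheme.{u}} (f : T ⟶ pluckerSpec.{u} s t) (a b : κ) : Γ(T, ⊤) :=
  f.appTop ((Scheme.ΓSpecIso (CommRingCat.of (PluckerRing.{u} s t))).inv (pluckerGen s t a b))

lemma specCoords_comp {T T' : Scheme.{u}} (g : T' ⟶ T) (f : T ⟶ pluckerSpec.{u} s t) :
    specCoords (g ≫ f) = fun a b => g.appTop (specCoords f a b) := rfl

lemma isPlucker_specCoords {T : Scheme.{u}} (f : T ⟶ pluckerSpec.{u} s t) :
    IsPlucker s t (specCoords f) :=
  (isPlucker_pluckerGen s t).map (((Scheme.ΓSpecIso _).inv ≫ f.appTop).hom)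

lemma specCoords_injective {T : Scheme.{u}} {f g : T ⟶ pluckerSpec.{u} s t}
    (h : specCoords f = specCoords g) : f = g := by
  apply ext_to_Spec
  ext1
  apply pluckerRing_hom_ext
  intro a b
  exact congrFun (congrFun h a) b

lemma exists_specCoords_eq {T : Scheme.{u}} {W : κ → κ → Γ(T, ⊤)} (hW : IsPlucker s t W) :
    ∃ f : T ⟶ pluckerSpec.{u} s t, specCoords f = W := by
  refine ⟨T.toSpecΓ ≫ Spec.map (CommRingCat.ofHom (pluckerLift hW)), ?_⟩
  ext a b
  simp [specCoords, pluckerLift_gen]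

/-- The Plücker coordinates of a point of `pluckerScheme`. -/
def pluckerCoords {k : Scheme.{u}} {T : Scheme.{u}} (f : T ⟶ (pluckerScheme s t k).left) (a b : κ) :
    Γ(T, ⊤) :=
  specCoords (f ≫ toPluckerSpec s t k) a b

variable {k : Scheme.{u}}

lemma pluckerCoords_comp {T T' : Scheme.{u}} (g : T' ⟶ T) (f : T ⟶ (pluckerScheme s t k).left) :
    pluckerCoords (g ≫ f) = fun a b => g.appTop (pluckerCoords f a b) := by
  ext a b
  rw [pluckerCoords, Category.assoc, specCoords_comp]
  rfl

lemma isPlucker_pluckerCoords {T : Scheme.{u}} (f : T ⟶ (pluckerScheme s t k).left) :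
    IsPlucker s t (pluckerCoords f) :=
  isPlucker_specCoords _

lemma pluckerScheme_hom_ext {T : Scheme.{u}} {f g : T ⟶ (pluckerScheme s t k).left}
    (h : f ≫ (pluckerScheme s t k).hom = g ≫ (pluckerScheme s t k).hom)
    (h' : pluckerCoords f = pluckerCoords g) : f = g :=
  pullback.hom_ext h (specCoords_injective h')

lemma exists_pluckerCoords_eq {T : Scheme.{u}} (x : T ⟶ k) {W : κ → κ → Γ(T, ⊤)}
    (hW : IsPlucker s t W) : ∃ f : T ⟶ (pluckerScheme s t k).left,
      f ≫ (pluckerScheme s t k).hom = x ∧ pluckerCoords f = W := by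
  obtain ⟨f, rfl⟩ := exists_specCoords_eq hW
  refine ⟨pullback.lift x f (terminal.hom_ext _ _), pullback.lift_fst _ _ _, ?_⟩
  ext a b
  exact congrArg (specCoords · a b) (pullback.lift_snd _ _ _)

instance : IsAffineHom (pluckerScheme s t k).hom := by
  have h : IsAffineHom (terminal.from (pluckerSpec.{u} s t)) := inferInstance
  exact MorphismProperty.of_isPullback (P := @IsAffineHom)
    (IsPullback.of_hasPullback (terminal.from k) (terminal.from (pluckerSpec.{u} s t))).flip h

/-- The open subscheme of `pluckerScheme` on which the planes are not contained in the hyperplane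
with index `c`. -/
def offHyperplane (c : κ) : (pluckerScheme s t k).left.Opens :=
  ⨆ a, (pluckerScheme s t k).left.basicOpen (pluckerCoords (𝟙 _) a c)

lemma preimage_offHyperplane (c : κ) {T : Scheme.{u}} (f : T ⟶ (pluckerScheme s t k).left) :
    f ⁻¹ᵁ offHyperplane c = ⨆ a, T.basicOpen (pluckerCoords f a c) := by
  have h : pluckerCoords f = fun a b => f.appTop (pluckerCoords (𝟙 _) a b) := by
    rw [← pluckerCoords_comp, Category.comp_id]
  rw [h, offHyperplane, Scheme.Hom.preimage_iSup]
  simp only [Scheme.preimage_basicOpen_top]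

end PluckerScheme

lemma iSup_basicOpen_eq_top_of_span {T : Scheme.{u}} {κ : Type} (v : κ → Γ(T, ⊤))
    (h : Ideal.span (Set.range v) = ⊤) : ⨆ a, T.basicOpen (v a) = ⊤ := by
  have := iSup_basicOpen_of_span_eq_top ⊤ _ h
  rwa [iSup_range] at this

/-- Affineness is essential: on the punctured plane the two coordinates have covering basic opens
but do not generate the unit ideal. -/
lemma span_eq_top_of_iSup_basicOpen {T : Scheme.{u}} [IsAffine T] {κ : Type} (v : κ → Γ(T, ⊤))
    (h : ⨆ a, T.basicOpen (v a) = ⊤) : Ideal.span (Set.range v) = ⊤ := by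
  refine ((isAffineOpen_top T).iSup_basicOpen_eq_self_iff).1 (Eq.trans ?_ h)
  rw [iSup_subtype, iSup_range]

end QuatProj

end
noncomputable section

namespace QuatProj

/-! ### A model of the stratum -/

section StratumScheme

variable (k : Scheme.{u}) (n i : ℕ)

/-- A model of the stratum: the planes in `E_i^⊥` on which the form is nondegenerate and which are
at no point contained in the hyperplane `E_{i+1}^⊥`. -/
def stratumScheme : Over k :=
  openSub (pluckerScheme (perpSrc n i) (perpTgt n i) k) (offHyperplane (.inr (none, 1)))

/-- The inclusion of the stratum in its closure. -/
def stratumIncl :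
    (stratumScheme k n i).left ⟶ (pluckerScheme (perpSrc n i) (perpTgt n i) k).left :=
  Scheme.Opens.ι _

instance : IsOpenImmersion (stratumIncl k n i) :=
  inferInstanceAs (IsOpenImmersion (Scheme.Opens.ι _))

lemma stratumIncl_over : stratumIncl k n i ≫ (pluckerScheme (perpSrc n i) (perpTgt n i) k).hom =
    (stratumScheme k n i).hom := rfl

lemma range_stratumIncl : Set.range (stratumIncl k n i) =
    (offHyperplane (s := perpSrc n i) (t := perpTgt n i) (k := k) (.inr (none, 1)) : Set _) :=
  Scheme.Opens.range_ι _

variable {k n i} {T : Scheme.{u}}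

/-- The Plücker coordinates of a point of the stratum. -/
def stratumCoords (f : T ⟶ (stratumScheme k n i).left) : PerpIdx n i → PerpIdx n i → Γ(T, ⊤) :=
  pluckerCoords (f ≫ stratumIncl k n i)

lemma stratumCoords_comp {T' : Scheme.{u}} (g : T' ⟶ T) (f : T ⟶ (stratumScheme k n i).left) :
    stratumCoords (g ≫ f) = fun a b => g.appTop (stratumCoords f a b) := by
  rw [stratumCoords, Category.assoc, pluckerCoords_comp]
  rfl

lemma isPlucker_stratumCoords (f : T ⟶ (stratumScheme k n i).left) :
    IsPlucker (perpSrc n i) (perpTgt n i) (stratumCoords f) :=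
  isPlucker_pluckerCoords _

lemma iSup_basicOpen_stratumCoords (f : T ⟶ (stratumScheme k n i).left) :
    ⨆ a, T.basicOpen (stratumCoords f a (.inr (none, 1))) = ⊤ := by
  rw [stratumCoords, ← preimage_offHyperplane, eq_top_iff]
  intro x _
  have : (f ≫ stratumIncl k n i) x ∈ Set.range (stratumIncl k n i) := ⟨f x, by simp⟩
  rwa [range_stratumIncl] at this

lemma stratumScheme_hom_ext {f g : T ⟶ (stratumScheme k n i).left}
    (h : f ≫ (stratumScheme k n i).hom = g ≫ (stratumScheme k n i).hom)
    (h' : stratumCoords f = stratumCoords g) : f = g := by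
  rw [← cancel_mono (stratumIncl k n i)]
  refine pluckerScheme_hom_ext ?_ h'
  rw [Category.assoc, Category.assoc, stratumIncl_over, h]

lemma exists_stratumCoords_eq (x : T ⟶ k) {W : PerpIdx n i → PerpIdx n i → Γ(T, ⊤)}
    (hW : IsPlucker (perpSrc n i) (perpTgt n i) W)
    (h : ⨆ a, T.basicOpen (W a (.inr (none, 1))) = ⊤) :
    ∃ f : T ⟶ (stratumScheme k n i).left, f ≫ (stratumScheme k n i).hom = x ∧
      stratumCoords f = W := by
  obtain ⟨f, rfl, rfl⟩ := exists_pluckerCoords_eq x hW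
  have hr : Set.range f ⊆ Set.range (stratumIncl k n i) := by
    rw [range_stratumIncl]
    rintro _ ⟨y, rfl⟩
    rw [← preimage_offHyperplane] at h
    exact (h.symm ▸ trivial : y ∈ f ⁻¹ᵁ offHyperplane (.inr (none, 1)))
  refine ⟨IsOpenImmersion.lift (stratumIncl k n i) f hr, ?_, ?_⟩
  · rw [← stratumIncl_over, ← Category.assoc, IsOpenImmersion.lift_fac]
  · rw [stratumCoords, IsOpenImmersion.lift_fac]

section Affine

variable {R : CommRingCat.{u}}

/-- The Plücker coordinates of an affine point of the stratum. -/
def affineCoords (y : Spec R ⟶ (stratumScheme k n i).left) (a b : PerpIdx n i) : R :=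
  (Scheme.ΓSpecIso R).hom (stratumCoords y a b)

lemma affineCoords_comp {R' : CommRingCat.{u}} (g : R ⟶ R')
    (y : Spec R ⟶ (stratumScheme k n i).left) :
    affineCoords (Spec.map g ≫ y) = fun a b => g.hom (affineCoords y a b) := by
  ext a b
  have := ConcreteCategory.congr_hom (Scheme.ΓSpecIso_naturality g) (stratumCoords y a b)
  simp only [affineCoords, stratumCoords_comp]
  exact this

lemma isPlucker_affineCoords (y : Spec R ⟶ (stratumScheme k n i).left) :
    IsPlucker (perpSrc n i) (perpTgt n i) (affineCoords y) :=
  (isPlucker_stratumCoords y).map (Scheme.ΓSpecIso R).hom.hom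

lemma span_stratumCoords [IsAffine T] (y : T ⟶ (stratumScheme k n i).left) :
    Ideal.span (Set.range fun a => stratumCoords y a (.inr (none, 1))) = ⊤ :=
  span_eq_top_of_iSup_basicOpen _ (iSup_basicOpen_stratumCoords y)

lemma span_affineCoords (y : Spec R ⟶ (stratumScheme k n i).left) :
    Ideal.span (Set.range fun a => affineCoords y a (.inr (none, 1))) = ⊤ := by
  have h := congrArg (Ideal.map (Scheme.ΓSpecIso R).hom.hom) (span_stratumCoords y)
  rw [Ideal.map_span, Ideal.map_top, ← Set.range_comp] at h
  exact h

/-- The model of the stratum represents the functor of points of the stratum. -/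
def isStratum_stratumScheme (hi : i ≤ n) : IsStratum n i (stratumScheme k n i) where
  taut y := rowSpan (perpExt hi (affineCoords y))
  taut_mem y := (isPlucker_affineCoords y).mem_stratumPoints hi (span_affineCoords y)
  taut_comp g y := by
    rw [pullbackSub_rowSpan, perpExt_map, affineCoords_comp]
  existsUnique {R} x U hU := by
    obtain ⟨W, hW, h1, rfl⟩ := exists_isPlucker_of_mem_stratumPoints hi hU
    have hW' := hW.map (Scheme.ΓSpecIso R).inv.hom
    have h1' := congrArg (Ideal.map (Scheme.ΓSpecIso R).inv.hom) h1
    rw [Ideal.map_span, Ideal.map_top, ← Set.range_comp] at h1'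
    obtain ⟨f, hf, hfW⟩ := exists_stratumCoords_eq x hW' (iSup_basicOpen_eq_top_of_span _ h1')
    have hf' : affineCoords f = W := by
      ext a b
      rw [affineCoords, hfW]
      exact ConcreteCategory.congr_hom (Scheme.ΓSpecIso R).inv_hom_id (W a b)
    refine ⟨f, ⟨hf, by rw [hf']⟩, ?_⟩
    rintro g ⟨hg, hg'⟩
    refine stratumScheme_hom_ext (hg.trans hf.symm) ?_
    have h2 := ((isPlucker_affineCoords g).perpExt hi).eq_of_rowSpan_eq (hW.perpExt hi) hg'
    have h3 := perpExt_injective hi h2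
    rw [← hf'] at h3
    ext a b
    exact (ConcreteCategory.bijective_of_isIso (Scheme.ΓSpecIso R).hom).1
      (congrFun (congrFun h3 a) b)

end Affine

end StratumScheme

/-! ### The action of the additive group -/

section Points

variable {k : Scheme.{u}} {ι : Type u} {T T' : Over k}

lemma coordsOf_pointOf (v : ι → Γ(T.left, ⊤)) : coordsOf (pointOf T v) = v := by
  ext j
  exact AffineSpace.homOfVector_appTop_coord _ _ _

lemma coordsOf_injective {x y : T ⟶ affineSp k ι} (h : coordsOf x = coordsOf y) : x = y := by
  ext1
  refine AffineSpace.hom_ext ?_ fun j => congrFun h j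
  exact (Over.w x).trans (Over.w y).symm

lemma coordsOf_comp (f : T' ⟶ T) (x : T ⟶ affineSp k ι) :
    coordsOf (f ≫ x) = fun j => f.left.appTop (coordsOf x j) := rfl

lemma pointOf_coordsOf (x : T ⟶ affineSp k ι) : pointOf T (coordsOf x) = x :=
  coordsOf_injective (coordsOf_pointOf _)

variable {n i : ℕ}

/-- The formula is polynomial, so it commutes with the map on global sections induced by a
`T`-point. -/
lemma coordsOf_actBy (t : Γ(T.left, ⊤)) (x : T ⟶ affineSp k (CellIdx.{u} n i)) :
    coordsOf (actBy (cellAction k n i) t x) = cellFormula n i t (coordsOf x) := by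
  rw [actBy, coordsOf_comp, cellAction, coordsOf_pointOf]
  refine (cellFormula_map (lift (pointOf T fun _ => t) x).left.appTop.hom _ _).symm.trans ?_
  congr 1
  · have := coordsOf_comp (lift (pointOf T fun _ => t) x)
      (fst (affineLine k) (affineSp k (CellIdx.{u} n i)))
    rw [lift_fst, coordsOf_pointOf] at this
    exact (congrFun this ⟨⟩).symm
  · have := coordsOf_comp (lift (pointOf T fun _ => t) x)
      (snd (affineLine k) (affineSp k (CellIdx.{u} n i)))
    rw [lift_snd] at this
    exact this.symm

lemma isGaAction_cellAction : IsGaAction (cellAction k n i) where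
  zero_act x := coordsOf_injective (by rw [coordsOf_actBy, cellFormula_zero])
  add_act s t x := coordsOf_injective (by simp only [coordsOf_actBy, cellFormula_add])

lemma isFreeGa_cellAction : IsFreeGa (cellAction k n i) := fun t x h =>
  cellFormula_eq_self (by rw [← coordsOf_actBy, h])

end Points

/-! ### The quotient -/

section Quotient

variable (k : Scheme.{u}) (n i : ℕ)

lemma exists_cellProj : ∃ π : affineSp k (CellIdx.{u} n i) ⟶ stratumScheme k n i,
    stratumCoords π.left = cellW (coordsOf (𝟙 (affineSp k (CellIdx.{u} n i)))) := by
  obtain ⟨f, hf, hfW⟩ := exists_stratumCoords_eq (affineSp k (CellIdx.{u} n i)).hom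
    (isPlucker_cellW (coordsOf (𝟙 (affineSp k (CellIdx.{u} n i)))))
    (iSup_basicOpen_eq_top_of_span _ (by simp only [cellW_right]; exact sum_cellU _))
  exact ⟨Over.homMk f hf, hfW⟩

/-- The map sending `(α, a, β, b, r)` to the plane spanned by `u` and `v`. -/
def cellProj : affineSp k (CellIdx.{u} n i) ⟶ stratumScheme k n i :=
  (exists_cellProj k n i).choose

variable {k n i} {T : Over k}

lemma stratumCoords_comp_cellProj (x : T ⟶ affineSp k (CellIdx.{u} n i)) :
    stratumCoords (x ≫ cellProj k n i).left = cellW (coordsOf x) := by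
  rw [Over.comp_left, stratumCoords_comp, cellProj, (exists_cellProj k n i).choose_spec,
    ← Category.comp_id x, coordsOf_comp, Category.comp_id]
  exact (cellW_map x.left.appTop.hom _).symm

lemma comp_cellProj_eq_iff (x y : T ⟶ affineSp k (CellIdx.{u} n i)) :
    x ≫ cellProj k n i = y ≫ cellProj k n i ↔ cellW (coordsOf x) = cellW (coordsOf y) := by
  rw [← stratumCoords_comp_cellProj, ← stratumCoords_comp_cellProj]
  refine ⟨fun h => by rw [h], fun h => ?_⟩
  ext1
  refine stratumScheme_hom_ext ?_ h
  rw [Over.w, Over.w]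

lemma cellAction_comp_cellProj : cellAction k n i ≫ cellProj k n i =
    snd (affineLine k) (affineSp k (CellIdx.{u} n i)) ≫ cellProj k n i := by
  rw [comp_cellProj_eq_iff, cellAction, coordsOf_pointOf, cellW_cellFormula]

/-- If `v' = v + t u`, then `φ(v', v) = t`. This recovers the group element from two points over the
same plane and gives both existence and uniqueness of the lift. -/
lemma isPullback_cellProj : IsPullback (cellAction k n i)
    (snd (affineLine k) (affineSp k (CellIdx.{u} n i))) (cellProj k n i) (cellProj k n i) := by
  refine ⟨⟨cellAction_comp_cellProj⟩, ⟨PullbackCone.IsLimit.mk _ (fun c =>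
    lift (pointOf _ fun _ => pform (perpSrc n i) (perpTgt n i) (cellV (coordsOf c.fst))
      (cellV (coordsOf c.snd))) c.snd) ?_ ?_ ?_⟩⟩
  · intro c
    refine coordsOf_injective ((coordsOf_actBy _ _).trans ?_)
    exact (eq_cellFormula_of_cellW_eq ((comp_cellProj_eq_iff _ _).1 c.condition.symm)).symm
  · intro c
    exact lift_snd _ _
  · intro c m h1 h2
    have h : m = lift (pointOf _ (coordsOf (m ≫ fst _ _))) c.snd := by
      rw [pointOf_coordsOf]
      ext1 <;> simp [h2]
    rw [h]
    congr 2
    ext ⟨⟩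
    set t := coordsOf (m ≫ fst _ _) ⟨⟩ with ht
    have h3 : c.fst = actBy (cellAction k n i) t c.snd := by
      rw [← h1, h]
      rfl
    have h4 : coordsOf c.fst = cellFormula n i t (coordsOf c.snd) := by rw [h3, coordsOf_actBy]
    rw [h4, cellV_cellFormula, pform_add_left, pform_self, pform_smul_left, pform_cell]
    ring

/-- Sections of `cellProj` exist over affine schemes. -/
lemma exists_cellProj_lift {T : Scheme.{u}} [IsAffine T] (f : T ⟶ (stratumScheme k n i).left) :
    ∃ s : T ⟶ (affineSp k (CellIdx.{u} n i)).left, s ≫ (cellProj k n i).left = f := by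
  obtain ⟨x, hx⟩ := exists_cellW_eq (isPlucker_stratumCoords f) (span_stratumCoords f)
  let T' : Over k := Over.mk (f ≫ (stratumScheme k n i).hom)
  let y : T' ⟶ affineSp k (CellIdx.{u} n i) := pointOf T' x
  refine ⟨y.left, stratumScheme_hom_ext ?_ ?_⟩
  · rw [Category.assoc, Over.w, Over.w]
    rfl
  · have := stratumCoords_comp_cellProj y
    rw [coordsOf_pointOf, hx] at this
    exact this

end Quotient

end QuatProj

end
noncomputable section

namespace QuatProj

/-! ### Locally split morphisms as categorical quotients. -/

section Coequalizer

/-- The open cover attached to a family of open subschemes containing all points. -/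
def pointCover {X : Scheme.{u}} (U : X → X.Opens) (hU : ∀ x, x ∈ U x) : X.OpenCover :=
  X.openCoverOfIsOpenCover U (.mk (eq_top_iff.2 fun x _ =>
    TopologicalSpace.Opens.mem_iSup.2 ⟨x, hU x⟩))

/-- A Zariski locally split morphism is the coequalizer of its kernel pair. -/
lemma nonempty_isColimit_of_locallySplit {k : Scheme.{u}} {E P X : Over k} {p q : E ⟶ P}
    {π : P ⟶ X} (h : IsPullback p q π π) (hs : ∀ x : X.left, ∃ U : X.left.Opens, x ∈ U ∧
      ∃ s : (U : Scheme.{u}) ⟶ P.left, s ≫ π.left = U.ι) :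
    Nonempty (IsColimit (Cofork.ofπ π h.w)) := by
  -- Two lifts to `P` of the same point of `X` come from one point of the kernel pair `E`, so `φ`
  -- cannot tell them apart. Hence the composites of `φ` with local sections glue.
  have key {Z : Over k} (φ : P ⟶ Z) (hφ : p ≫ φ = q ≫ φ) {T : Scheme.{u}} (a b : T ⟶ P.left)
      (hab : a ≫ π.left = b ≫ π.left) : a ≫ φ.left = b ≫ φ.left := by
    have hw : b ≫ P.hom = a ≫ P.hom := by rw [← Over.w π, reassoc_of% hab]
    let a' : Over.mk (a ≫ P.hom) ⟶ P := Over.homMk a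
    let b' : Over.mk (a ≫ P.hom) ⟶ P := Over.homMk b hw
    have hab' : a' ≫ π = b' ≫ π := by ext1; exact hab
    have h1 : a' ≫ φ = b' ≫ φ := by
      rw [← h.lift_fst a' b' hab', Category.assoc, hφ, ← Category.assoc, h.lift_snd]
    exact congrArg (fun f => f.left) h1
  choose U hU s hs using hs
  have glue {Z : Over k} (φ : P ⟶ Z) (hφ : p ≫ φ = q ≫ φ) :
      ∃ g : X ⟶ Z, π ≫ g = φ := by
    have hc (x y : X.left) : pullback.fst (U x).ι (U y).ι ≫ s x ≫ φ.left =
        pullback.snd (U x).ι (U y).ι ≫ s y ≫ φ.left := by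
      have := key φ hφ (pullback.fst (U x).ι (U y).ι ≫ s x) (pullback.snd (U x).ι (U y).ι ≫ s y)
        (by rw [Category.assoc, Category.assoc, hs, hs, pullback.condition])
      rwa [Category.assoc, Category.assoc] at this
    let g : X.left ⟶ Z.left := (pointCover U hU).glueMorphisms (fun x => s x ≫ φ.left) hc
    have hg (x : X.left) : (U x).ι ≫ g = s x ≫ φ.left := (pointCover U hU).ι_glueMorphisms _ _ x
    have hπ : π.left ≫ g = φ.left := by
      -- Over the preimage of a trivializing open set, the inclusion and the section after `π` are
      -- two lifts of the same point, so `key` applies.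
      refine Scheme.hom_ext_of_forall _ _ fun y => ⟨π.left ⁻¹ᵁ U (π.left y), hU _, ?_⟩
      rw [← morphismRestrict_ι_assoc, hg, ← Category.assoc]
      refine key φ hφ _ _ ?_
      rw [Category.assoc, hs, morphismRestrict_ι]
    refine ⟨Over.homMk g ?_, by ext1; exact hπ⟩
    refine Scheme.hom_ext_of_forall _ _ fun x => ⟨U x, hU x, ?_⟩
    rw [← Category.assoc, hg, Category.assoc, Over.w, ← Over.w π, ← Category.assoc, hs]
  refine ⟨Cofork.IsColimit.mk _ (fun c => (glue c.π c.condition).choose)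
    (fun c => (glue c.π c.condition).choose_spec) fun c m hm => ?_⟩
  have h1 : π ≫ m = π ≫ (glue c.π c.condition).choose :=
    hm.trans (glue c.π c.condition).choose_spec.symm
  ext1
  refine Scheme.hom_ext_of_forall _ _ fun x => ⟨U x, hU x, ?_⟩
  have h2 : π.left ≫ m.left = π.left ≫ Over.Hom.left (glue c.π c.condition).choose :=
    congrArg (fun f => f.left) h1
  rw [← hs, Category.assoc, Category.assoc, h2]

/-- Every scheme isomorphic to the model of the stratum is the quotient by the action. -/
lemma isGaQuotient_of_iso {k : Scheme.{u}} {n i : ℕ} {X : Over k} (e : stratumScheme k n i ≅ X) :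
    IsGaQuotient (cellAction k n i) (cellProj k n i ≫ e.hom) := by
  have hp : IsPullback (cellAction k n i) (snd (affineLine k) (affineSp k (CellIdx.{u} n i)))
      (cellProj k n i ≫ e.hom) (cellProj k n i ≫ e.hom) :=
    IsKernelPair.comp_of_mono isPullback_cellProj
  have hs (x : X.left) : ∃ U : X.left.Opens, x ∈ U ∧ ∃ s : (U : Scheme.{u}) ⟶
      (affineSp k (CellIdx.{u} n i)).left, s ≫ (cellProj k n i ≫ e.hom).left = U.ι := by
    obtain ⟨U, hU, hxU⟩ := exists_isAffineOpen_mem_and_subset (U := ⊤) (x := x) trivial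
    have : IsAffine U := hU
    obtain ⟨s, hs⟩ := exists_cellProj_lift (U.ι ≫ e.inv.left)
    refine ⟨U, hxU.1, s, ?_⟩
    rw [Over.comp_left, ← Category.assoc, hs, Category.assoc, ← Over.comp_left, e.inv_hom_id,
      Over.id_left, Category.comp_id]
  exact ⟨hp, hs, nonempty_isColimit_of_locallySplit hp hs⟩

end Coequalizer

end QuatProj

end
noncomputable section

namespace QuatProj

/-! ### Open restrictions, pairs and local triviality. -/

lemma isPullback_of_left {k : Scheme.{u}} {X Y Z W : Over k} {f : X ⟶ Y} {g : X ⟶ Z} {h : Y ⟶ W}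
    {l : Z ⟶ W} (H : IsPullback f.left g.left h.left l.left) : IsPullback f g h l := by
  refine IsPullback.of_map (Over.forget k) ?_ H
  ext1
  exact H.w

/-- The inclusion of an open subscheme. -/
def openIncl {k : Scheme.{u}} (X : Over k) (U : X.left.Opens) : openSub X U ⟶ X :=
  Over.homMk U.ι

instance {k : Scheme.{u}} (X : Over k) (U : X.left.Opens) :
    IsOpenImmersion (openIncl X U).left :=
  inferInstanceAs (IsOpenImmersion U.ι)

lemma range_openIncl {k : Scheme.{u}} (X : Over k) (U : X.left.Opens) :
    Set.range (openIncl X U).left = U :=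
  U.range_ι

/-- The restriction of a morphism to the preimage of an open subscheme. -/
def openRestrict {k : Scheme.{u}} {E Y : Over k} (p : E ⟶ Y) (U : Y.left.Opens) :
    openSub E (p.left ⁻¹ᵁ U) ⟶ openSub Y U :=
  Over.homMk (p.left ∣_ U) (by
    change (p.left ∣_ U) ≫ U.ι ≫ Y.hom = (p.left ⁻¹ᵁ U).ι ≫ E.hom
    rw [morphismRestrict_ι_assoc, Over.w])

lemma isPullback_openRestrict {k : Scheme.{u}} {E Y : Over k} (p : E ⟶ Y) (U : Y.left.Opens) :
    IsPullback (openIncl E (p.left ⁻¹ᵁ U)) (openRestrict p U) p (openIncl Y U) :=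
  isPullback_of_left (isPullback_morphismRestrict p.left U).flip

/-- A morphism whose image lies in an open subscheme factors through it. -/
lemma exists_comp_openIncl {k : Scheme.{u}} {T Y : Over k} (f : T ⟶ Y) {D : Y.left.Opens}
    (h : Set.range f.left ⊆ D) : ∃ g : T ⟶ openSub Y D, g ≫ openIncl Y D = f := by
  have h' : Set.range f.left ⊆ Set.range D.ι := by rwa [D.range_ι]
  have hg := IsOpenImmersion.lift_fac D.ι f.left h'
  refine ⟨Over.homMk (IsOpenImmersion.lift D.ι f.left h') ?_, ?_⟩
  · change _ ≫ D.ι ≫ Y.hom = _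
    rw [reassoc_of% hg, Over.w]
  · ext1
    exact hg

section Admissible

variable {k : Scheme.{u}} {V : ObjectProperty (Over k)} (hV : IsAdmissible V)

include hV

lemma IsAdmissible.quasiCompact {E Y : Over k} (hE : V E) (hY : V Y) (p : E ⟶ Y) :
    QuasiCompact p.left := by
  have := hV.compactSpace hE
  have := hV.quasiSeparatedSpace hY
  infer_instance

lemma IsAdmissible.isCompact_of_mem {Y : Over k} {U : Y.left.Opens} (hU : V (openSub Y U)) :
    IsCompact (U : Set Y.left) :=
  isCompact_iff_compactSpace.2 (hV.compactSpace hU)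

lemma IsAdmissible.preimage_mem {E Y : Over k} (hE : V E) (hY : V Y) (p : E ⟶ Y)
    {U : Y.left.Opens} (hU : IsCompact (U : Set Y.left)) : V (openSub E (p.left ⁻¹ᵁ U)) := by
  have := hV.quasiCompact hE hY p
  exact hV.open_mem hE _ (p.left.isCompact_preimage hU)

end Admissible

section Pairs

variable {k : Scheme.{u}} {V : ObjectProperty (Over k)}

/-- The preimage of a pair under a morphism. -/
abbrev preimagePair (Q : VPair V) {E : Over k} (p : E ⟶ Q.X) (hE : V E)
    (hE' : V (openSub E (p.left ⁻¹ᵁ Q.Z.compl))) : VPair V where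
  X := E
  Z := Q.Z.preimage p.left.continuous
  mem := hE
  compl_mem := hE'

/-- The morphism from the preimage of a pair. -/
def preimageMap (Q : VPair V) {E : Over k} (p : E ⟶ Q.X) (hE : V E)
    (hE' : V (openSub E (p.left ⁻¹ᵁ Q.Z.compl))) : preimagePair Q p hE hE' ⟶ Q :=
  VPair.Hom.mk p fun _ h => h

end Pairs

section LocalTriviality

variable {k : Scheme.{u}}

/-- Local triviality of `p` along `f`: the base change is a trivial line bundle. -/
def TrivOver {E Y T : Over k} (p : E ⟶ Y) (f : T ⟶ Y) : Prop :=
  ∃ τ : T ⊗ affineLine k ⟶ E, IsPullback τ (fst T (affineLine k)) p f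

lemma isPullback_whiskerRight_fst {T' T : Over k} (h : T' ⟶ T) (L : Over k) :
    IsPullback (h ▷ L) (fst T' L) (fst T L) h := by
  refine ⟨⟨by simp⟩, ⟨PullbackCone.IsLimit.mk _
    (fun c => lift c.snd (c.fst ≫ snd T L)) (fun c => ?_) (fun c => ?_) fun c m h₁ h₂ => ?_⟩⟩
  · ext1
    · simpa using c.condition.symm
    · simp
  · simp
  · ext1
    · simpa using h₂
    · simp [← h₁]

lemma TrivOver.precomp {E Y T T' : Over k} {p : E ⟶ Y} {f : T ⟶ Y}
    (h : TrivOver p f) (g : T' ⟶ T) : TrivOver p (g ≫ f) := by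
  obtain ⟨τ, h⟩ := h
  exact ⟨_, (isPullback_whiskerRight_fst g _).paste_horiz h⟩

end LocalTriviality

/-! ### Five lemma, Mayer–Vietoris and line bundle torsors. -/

namespace CohomologyTheory

variable {k : Scheme.{u}} {V : ObjectProperty (Over k)} {hV : IsAdmissible V}
  (A : CohomologyTheory.{w} hV)

lemma pull_comp {X Y Z : Over k} (hX : V X) (hY : V Y) (hZ : V Z) (f : X ⟶ Y) (g : Y ⟶ Z) :
    A.pull hX hZ (f ≫ g) = A.pull hY hZ g ≫ A.pull hX hY f := by
  unfold pull
  rw [← A.A.map_comp, ← op_comp]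
  rfl

lemma pull_id {X : Over k} (hX hX' : V X) : A.pull hX hX' (𝟙 X) = 𝟙 _ :=
  A.A.map_id _

instance isIso_pull {X Y : Over k} (hX : V X) (hY : V Y) (f : X ⟶ Y) [IsIso f] :
    IsIso (A.pull hX hY f) := by
  refine ⟨A.pull hY hX (inv f), ?_, ?_⟩
  · rw [← pull_comp, IsIso.inv_hom_id, pull_id]
  · rw [← pull_comp, IsIso.hom_inv_id, pull_id]

section FiveLemma

variable {P Q : VPair V} (F : P ⟶ Q) (g : complPair hV P ⟶ complPair hV Q)
  (hg : g ≫ resMap hV Q = resMap hV P ≫ fullMap hV P.mem Q.mem F.f)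

include hg in
lemma map_res_comp : A.A.map (resMap hV Q).op ≫ A.A.map g.op =
    A.pull P.mem Q.mem F.f ≫ A.A.map (resMap hV P).op := by
  unfold pull
  rw [← A.A.map_comp, ← A.A.map_comp, ← op_comp, ← op_comp, hg]

lemma map_ext_comp : A.A.map (extMap hV Q).op ≫ A.pull P.mem Q.mem F.f =
    A.A.map F.op ≫ A.A.map (extMap hV P).op := by
  unfold pull
  rw [← A.A.map_comp, ← A.A.map_comp, ← op_comp, ← op_comp]
  congr 2

include hg in
-- Five lemma for `A(X) → A(X ∖ Z) → A_Z(X) → A(X) → A(X ∖ Z)`.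
lemma isIso_map_of_isIso_pull (h₁ : IsIso (A.pull P.mem Q.mem F.f)) (h₂ : IsIso (A.A.map g.op)) :
    IsIso (A.A.map F.op) := by
  rw [ConcreteCategory.isIso_iff_bijective] at h₁ h₂ ⊢
  have c₁ := congrArg AddCommGrpCat.Hom.hom (A.map_res_comp F g hg)
  have c₂ := congrArg AddCommGrpCat.Hom.hom (A.bd_natural F g hg)
  have c₃ := congrArg AddCommGrpCat.Hom.hom (A.map_ext_comp F)
  exact AddMonoidHom.bijective_of_surjective_of_bijective_of_bijective_of_injective
    (A.A.map (resMap hV Q).op).hom (A.bd Q).hom (A.A.map (extMap hV Q).op).hom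
    (A.A.map (resMap hV Q).op).hom
    (A.A.map (resMap hV P).op).hom (A.bd P).hom (A.A.map (extMap hV P).op).hom
    (A.A.map (resMap hV P).op).hom
    (A.pull P.mem Q.mem F.f).hom (A.A.map g.op).hom (A.A.map F.op).hom
    (A.pull P.mem Q.mem F.f).hom (A.A.map g.op).hom
    c₁.symm c₂.symm c₃.symm c₁.symm (A.exact_open Q) (A.exact_supp Q) (A.exact_total Q)
    (A.exact_open P) (A.exact_supp P) (A.exact_total P) h₁.2 h₂ h₁ h₂.1

include hg in
-- Five lemma for the same periodic sequence, shifted so that `A(X)` stands in the middle.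
lemma isIso_pull_of_isIso_map (h₁ : IsIso (A.A.map F.op)) (h₂ : IsIso (A.A.map g.op)) :
    IsIso (A.pull P.mem Q.mem F.f) := by
  rw [ConcreteCategory.isIso_iff_bijective] at h₁ h₂ ⊢
  have c₁ := congrArg AddCommGrpCat.Hom.hom (A.map_res_comp F g hg)
  have c₂ := congrArg AddCommGrpCat.Hom.hom (A.bd_natural F g hg)
  have c₃ := congrArg AddCommGrpCat.Hom.hom (A.map_ext_comp F)
  exact AddMonoidHom.bijective_of_surjective_of_bijective_of_bijective_of_injective
    (A.bd Q).hom (A.A.map (extMap hV Q).op).hom (A.A.map (resMap hV Q).op).hom (A.bd Q).hom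
    (A.bd P).hom (A.A.map (extMap hV P).op).hom (A.A.map (resMap hV P).op).hom (A.bd P).hom
    (A.A.map g.op).hom (A.A.map F.op).hom (A.pull P.mem Q.mem F.f).hom (A.A.map g.op).hom
    (A.A.map F.op).hom
    c₂.symm c₃.symm c₁.symm c₂.symm (A.exact_supp Q) (A.exact_total Q) (A.exact_open Q)
    (A.exact_supp P) (A.exact_total P) (A.exact_open P) h₂.2 h₁ h₂ h₁.1

end FiveLemma

/-- Pullback along `p` is an isomorphism. -/
def PullIso {E Y : Over k} (p : E ⟶ Y) : Prop :=
  ∀ (hE : V E) (hY : V Y), IsIso (A.pull hE hY p)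

/-- Every base change of `p` along `f` induces an isomorphism. -/
def PullIsoOver {E Y T : Over k} (p : E ⟶ Y) (f : T ⟶ Y) : Prop :=
  ∀ {E' : Over k} (g : E' ⟶ E) (p' : E' ⟶ T), IsPullback g p' p f → A.PullIso p'

variable {A}

/-- Excision for an open neighbourhood of the support. -/
lemma isIso_map_of_isOpenImmersion {P Q : VPair V} (F : P ⟶ Q) [IsOpenImmersion F.f.left]
    (hF : ∀ x : P.X.left, F.f.left x ∈ Q.Z ↔ x ∈ P.Z)
    (hZ : (Q.Z : Set Q.X.left) ⊆ Set.range F.f.left) : IsIso (A.A.map F.op) := by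
  refine A.excision _ inferInstance hF ?_
  have h : Set.range (Scheme.IdealSheafData.vanishingIdeal Q.Z).subschemeι ⊆
      Set.range F.f.left := by
    rwa [Scheme.IdealSheafData.range_subschemeι,
      Scheme.IdealSheafData.coe_support_vanishingIdeal]
  -- The closed subscheme factors through the open immersion, so the projection has a section; being
  -- a base change of a monomorphism, it is an isomorphism.
  refine ⟨pullback.lift (𝟙 _) (IsOpenImmersion.lift F.f.left _ h) ?_, ?_, ?_⟩
  · rw [Category.id_comp]
    exact (IsOpenImmersion.lift_fac F.f.left _ h).symm
  · rw [← cancel_mono (pullback.fst _ _), Category.assoc, pullback.lift_fst, Category.comp_id,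
      Category.id_comp]
  · exact pullback.lift_fst _ _ _

/-- The map induced on complements by the preimage of a pair. -/
lemma complMap_comp (Q : VPair V) {E : Over k} (p : E ⟶ Q.X) (hE : V E)
    (hE' : V (openSub E (p.left ⁻¹ᵁ Q.Z.compl))) :
    (fullMap hV hE' Q.compl_mem (openRestrict p Q.Z.compl) :
      complPair hV (preimagePair Q p hE hE') ⟶ complPair hV Q) ≫ resMap hV Q =
    resMap hV (preimagePair Q p hE hE') ≫ fullMap hV hE Q.mem p :=
  VPair.Hom.ext (isPullback_openRestrict p Q.Z.compl).w.symm

/-- Mayer–Vietoris: a statement about pullbacks can be checked on the complement of a closed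
subset, a neighbourhood of this subset, and the intersection of these. -/
lemma pullIso_of_cover {E Y : Over k} (p : E ⟶ Y) (hE : V E) (hY : V Y) (Z : Closeds Y.left)
    (U : Y.left.Opens) (hZU : (Z : Set Y.left) ⊆ U) (hZ : IsCompact (Z.compl : Set Y.left))
    (hU : IsCompact (U : Set Y.left)) (h₁ : A.PullIsoOver p (openIncl Y Z.compl))
    (h₂ : A.PullIsoOver p (openIncl Y U))
    (h₃ : A.PullIsoOver p (openIncl (openSub Y U) ((openIncl Y U).left ⁻¹ᵁ Z.compl) ≫
      openIncl Y U)) : IsIso (A.pull hE hY p) := by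
  have hYZ := hV.open_mem hY _ hZ
  have hEZ := hV.preimage_mem hE hY p hZ
  have hYU := hV.open_mem hY _ hU
  have hEU := hV.preimage_mem hE hY p hU
  have hYUZ := hV.preimage_mem hYU hY (openIncl Y U) hZ
  let Q : VPair V := ⟨Y, Z, hY, hYZ⟩
  let P : VPair V := preimagePair Q p hE hEZ
  let F : P ⟶ Q := preimageMap Q p hE hEZ
  let Q' : VPair V := preimagePair Q (openIncl Y U) hYU hYUZ
  let J : Q' ⟶ Q := preimageMap Q (openIncl Y U) hYU hYUZ
  have hEUZ := hV.preimage_mem hEU hYU (openRestrict p U) (hV.isCompact_of_mem hYUZ)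
  let P' : VPair V := preimagePair Q' (openRestrict p U) hEU hEUZ
  let F' : P' ⟶ Q' := preimageMap Q' (openRestrict p U) hEU hEUZ
  have hq := isPullback_openRestrict p U
  have hset (x : (openSub E (p.left ⁻¹ᵁ U)).left) :
      (openIncl E (p.left ⁻¹ᵁ U)).left x ∈ P.Z ↔ x ∈ P'.Z := by
    have h := congrArg (fun f => f.left x) hq.w
    simp only [Over.comp_left, Scheme.Hom.comp_apply] at h
    change p.left _ ∈ Z ↔ (openIncl Y U).left _ ∈ Z
    rw [h]
  let J' : P' ⟶ P := VPair.Hom.mk (openIncl E (p.left ⁻¹ᵁ U)) fun x hx => (hset x).1 hx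
  have hsq : J' ≫ F = F' ≫ J := VPair.Hom.ext hq.w
  -- Excision moves the supports in `Z` from `Y` to `U`, and likewise upstairs in `E`, whatever `p`
  -- is.
  have hJ : IsIso (A.A.map J.op) := by
    have : IsOpenImmersion J.f.left := inferInstanceAs (IsOpenImmersion (openIncl Y U).left)
    refine isIso_map_of_isOpenImmersion J (fun _ => Iff.rfl) ?_
    exact hZU.trans (range_openIncl Y U).ge
  have hJ' : IsIso (A.A.map J'.op) := by
    have : IsOpenImmersion J'.f.left :=
      inferInstanceAs (IsOpenImmersion (openIncl E (p.left ⁻¹ᵁ U)).left)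
    refine isIso_map_of_isOpenImmersion J' hset ?_
    refine Set.Subset.trans ?_ (range_openIncl E (p.left ⁻¹ᵁ U)).ge
    exact fun x hx => hZU hx
  -- Over `U` the five lemma uses `h₂` and `h₃`. The excision square carries the result to `F`, and
  -- a second use of the five lemma, with `h₁`, returns to total cohomology.
  have hF' : IsIso (A.A.map F'.op) := by
    have i₁ : IsIso (A.pull P'.mem Q'.mem F'.f) := h₂ _ _ hq _ _
    have i₂ : IsIso (A.A.map (fullMap hV hEUZ Q'.compl_mem
        (openRestrict (openRestrict p U) Q'.Z.compl)).op) :=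
      h₃ _ _ ((isPullback_openRestrict (openRestrict p U) Q'.Z.compl).paste_horiz hq) hEUZ
        Q'.compl_mem
    exact A.isIso_map_of_isIso_pull F' _ (complMap_comp Q' (openRestrict p U) hEU hEUZ) i₁ i₂
  have hF : IsIso (A.A.map F.op) := by
    have h : A.A.map F.op ≫ A.A.map J'.op = A.A.map J.op ≫ A.A.map F'.op := by
      rw [← A.A.map_comp, ← A.A.map_comp, ← op_comp, ← op_comp, hsq]
    have : IsIso (A.A.map F.op ≫ A.A.map J'.op) := by rw [h]; infer_instance
    exact IsIso.of_isIso_comp_right _ (A.A.map J'.op)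
  have i₂ : IsIso (A.A.map (fullMap hV hEZ Q.compl_mem (openRestrict p Q.Z.compl)).op) :=
    h₁ _ _ (isPullback_openRestrict p Z.compl) hEZ hYZ
  exact A.isIso_pull_of_isIso_map F _ (complMap_comp Q p hE hEZ) hF i₂

/-- Any base change of `p` along `f` is isomorphic over `T` to `T × A¹`, so homotopy invariance
applies. -/
lemma _root_.QuatProj.TrivOver.pullIsoOver {E Y T : Over k} {p : E ⟶ Y} {f : T ⟶ Y}
    (h : TrivOver p f) : A.PullIsoOver p f := by
  obtain ⟨τ, h⟩ := h
  intro E' g p' h' hE hT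
  have he : (h'.isoIsPullback _ _ h).hom ≫ fst T (affineLine k) = p' :=
    h'.isoIsPullback_hom_snd _ _ h
  have hT' : V (T ⊗ affineLine k) := hV.iso_mem (h'.isoIsPullback _ _ h) hE
  have := A.homotopy T hT hT'
  have h₂ := A.pull_comp hE hT' hT (h'.isoIsPullback _ _ h).hom (fst T (affineLine k))
  rw [he] at h₂
  rw [h₂]
  have : IsIso (A.pull hT' hT (fst T (affineLine k))) := this
  infer_instance

variable (A) in
/-- Every base change of `p` along an open immersion with image in `D` induces an isomorphism. -/
def PullIsoBelow {E Y : Over k} (p : E ⟶ Y) (D : Y.left.Opens) : Prop :=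
  ∀ {T : Over k} (f : T ⟶ Y), IsOpenImmersion f.left → Set.range f.left ⊆ D → A.PullIsoOver p f

lemma PullIsoBelow.bot {E Y : Over k} (p : E ⟶ Y) : A.PullIsoBelow p ⊥ := by
  intro T f _ hf E' g p' _ hE hT
  have hT' : IsEmpty T.left := ⟨fun x => (hf ⟨x, rfl⟩ : _ ∈ (⊥ : Y.left.Opens))⟩
  have : IsIso ((Over.forget k).map p') := (isIso_of_isEmpty p'.left :)
  have : IsIso p' := isIso_of_reflects_iso p' (Over.forget k)
  infer_instance

/-- Take for `Z` the complement of the preimage of `D₁`; it lies in the preimage of `D₂`. The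
intersection required by Mayer–Vietoris is covered because `PullIsoBelow` ranges over all open
immersions into `D₂`. -/
lemma PullIsoBelow.sup {E Y : Over k} {p : E ⟶ Y} (hY : V Y) {D₁ D₂ : Y.left.Opens}
    (hD₁ : IsCompact (D₁ : Set Y.left)) (hD₂ : IsCompact (D₂ : Set Y.left))
    (H₁ : A.PullIsoBelow p D₁) (H₂ : A.PullIsoBelow p D₂) : A.PullIsoBelow p (D₁ ⊔ D₂) := by
  intro T f hf hD E' g p' h hE hT
  have := hV.quasiCompact hT hY f
  let Z : Closeds T.left := (f.left ⁻¹ᵁ D₁).compl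
  have hZ : Z.compl = f.left ⁻¹ᵁ D₁ := TopologicalSpace.Opens.compl_compl _
  have hc : (Z.compl : Set T.left) = (f.left ⁻¹ᵁ D₁ : T.left.Opens) := congrArg _ hZ
  have key {D : Y.left.Opens} (H : A.PullIsoBelow p D) {T' : Over k} (j : T' ⟶ T)
      (hj : IsOpenImmersion j.left) (hD : Set.range j.left ⊆ (f.left ⁻¹ᵁ D : T.left.Opens)) :
      A.PullIsoOver p' j := by
    intro E'' g' p'' h'
    refine H (j ≫ f) (inferInstanceAs (IsOpenImmersion (j.left ≫ f.left))) ?_ _ _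
      (h'.paste_horiz h)
    rintro _ ⟨x, rfl⟩
    exact hD ⟨x, rfl⟩
  refine pullIso_of_cover p' hE hT Z (f.left ⁻¹ᵁ D₂) ?_ ?_ ?_ ?_ ?_ ?_
  · intro x hx
    have : f.left x ∈ D₁ ⊔ D₂ := hD ⟨x, rfl⟩
    exact this.resolve_left hx
  · rw [hc]
    exact f.left.isCompact_preimage hD₁
  · exact f.left.isCompact_preimage hD₂
  · refine key H₁ _ inferInstance ?_
    rw [range_openIncl, hc]
  · exact key H₂ _ inferInstance (range_openIncl _ _).le
  · refine key H₂ _ (by rw [Over.comp_left]; infer_instance) ?_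
    rintro _ ⟨x, rfl⟩
    exact (range_openIncl T (f.left ⁻¹ᵁ D₂)).le ⟨_, rfl⟩

/-- Pullback along a Zariski locally trivial line bundle torsor is an isomorphism. -/
lemma isIso_pull_of_locally_trivOver {E Y : Over k} (p : E ⟶ Y) (hE : V E) (hY : V Y)
    (h : ∀ y : Y.left, ∃ D : Y.left.Opens, y ∈ D ∧ TrivOver p (openIncl Y D)) :
    IsIso (A.pull hE hY p) := by
  have := hV.compactSpace hY
  obtain ⟨D, hD, -, H⟩ : ∃ D : Y.left.Opens, (Set.univ : Set Y.left) ⊆ D ∧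
      IsCompact (D : Set Y.left) ∧ A.PullIsoBelow p D := by
    -- The opens are kept quasi-compact throughout so that all restrictions remain in `V`; for the
    -- local step the trivializing neighbourhood is shrunk to an affine one.
    refine isCompact_univ.induction_on (p := fun s => ∃ D : Y.left.Opens, s ⊆ (D : Set Y.left) ∧
      IsCompact (D : Set Y.left) ∧ A.PullIsoBelow p D) ?_ ?_ ?_ ?_
    · exact ⟨⊥, Set.empty_subset _, isCompact_empty, PullIsoBelow.bot p⟩
    · rintro s t hst ⟨D, hD, h⟩
      exact ⟨D, hst.trans hD, h⟩
    · rintro s t ⟨D, hD, hc, H⟩ ⟨D', hD', hc', H'⟩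
      exact ⟨D ⊔ D', Set.union_subset_union hD hD', hc.union hc', H.sup hY hc hc' H'⟩
    · intro y _
      obtain ⟨D, hy, H⟩ := h y
      obtain ⟨U, hU, hyU, hUD⟩ := exists_isAffineOpen_mem_and_subset hy
      refine ⟨U, mem_nhdsWithin_of_mem_nhds (U.isOpen.mem_nhds hyU), U, subset_rfl,
        hU.isCompact, fun f _ hf => ?_⟩
      obtain ⟨g, rfl⟩ := exists_comp_openIncl f (hf.trans hUD)
      exact (H.precomp g).pullIsoOver
  refine H (𝟙 Y) (inferInstanceAs (IsOpenImmersion (𝟙 Y.left))) (fun x _ => hD trivial) (𝟙 E) p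
    (IsPullback.of_horiz_isIso ⟨by simp⟩) hE hY

end CohomologyTheory

end QuatProj

end
noncomputable section

namespace QuatProj

/-! ### Recognizing open subschemes of Grassmannian bundles. -/

section OpenInGrassmannian

/-- The open complement of the zero locus of an ideal. -/
def idealOpen {R : CommRingCat.{u}} (I : Ideal R) : (Spec R).Opens :=
  ⟨(PrimeSpectrum.zeroLocus (I : Set R))ᶜ, (PrimeSpectrum.isClosed_zeroLocus _).isOpen_compl⟩

lemma forall_mem_idealOpen_iff {R R' : CommRingCat.{u}} (I : Ideal R) (g : R ⟶ R') :
    (∀ z : Spec R', Spec.map g z ∈ idealOpen I) ↔ I.map g.hom = ⊤ := by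
  rw [← PrimeSpectrum.zeroLocus_empty_iff_eq_top, Ideal.map, PrimeSpectrum.zeroLocus_span,
    ← PrimeSpectrum.preimage_comap_zeroLocus, Set.eq_empty_iff_forall_notMem]
  rfl

/-- If lifts exist exactly after those base changes that make an ideal `I` the unit ideal, the open
subscheme to take is the complement of the zero locus of `I`. -/
lemma isOpenInGrassmannian_of_ideal {k : Scheme.{u}} {r N : ℕ} {X Y : Over k} (p : Y ⟶ X)
    (taut : ∀ {R : CommRingCat.{u}}, (Spec R ⟶ Y.left) → Submodule R (Fin N → R))
    (hsub : ∀ {R : CommRingCat.{u}} (y : Spec R ⟶ Y.left), IsSubbundle r (taut y))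
    (hcomp : ∀ {R R' : CommRingCat.{u}} (g : R ⟶ R') (y : Spec R ⟶ Y.left),
      taut (Spec.map g ≫ y) = pullbackSub g.hom (taut y))
    (hext : ∀ {R : CommRingCat.{u}} (y y' : Spec R ⟶ Y.left), y ≫ p.left = y' ≫ p.left →
      taut y = taut y' → y = y')
    (hlift : ∀ {R : CommRingCat.{u}} (M : Submodule R (Fin N → R)), IsSubbundle r M →
      ∃ I : Ideal R, ∀ {R' : CommRingCat.{u}} (g : R ⟶ R') (x : Spec R' ⟶ X.left),
        (∃ y : Spec R' ⟶ Y.left, y ≫ p.left = x ∧ taut y = pullbackSub g.hom M) ↔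
          I.map g.hom = ⊤) : IsOpenInGrassmannian r N p := by
  refine ⟨taut, hsub, hcomp, fun {R} x M hM => ?_⟩
  obtain ⟨I, hI⟩ := hlift M hM
  refine ⟨idealOpen I, fun {R'} g => ⟨fun y y' h₁ h₂ h₃ h₄ => ?_, ?_⟩⟩
  · exact hext y y' (h₁.trans h₃.symm) (h₂.trans h₄.symm)
  · rw [forall_mem_idealOpen_iff, hI]

end OpenInGrassmannian

/-! ### Affine spaces in admissible categories -/

section Line

variable {R : Type u} [CommRing R]

/-- The line spanned by `(1, c)`. -/
def lineSub (c : R) : Submodule R (Fin 2 → R) := Submodule.span R {![1, c]}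

lemma mem_lineSub {c : R} {x : Fin 2 → R} : x ∈ lineSub c ↔ x 1 = x 0 * c := by
  rw [lineSub, Submodule.mem_span_singleton]
  constructor
  · rintro ⟨a, rfl⟩
    simp
  · intro h
    refine ⟨x 0, ?_⟩
    ext i
    fin_cases i
    · simp
    · simp [h]

lemma isSubbundle_lineSub (c : R) : IsSubbundle 1 (lineSub c) where
  projective_quotient := projective_quotient_of_retraction
    ((LinearMap.proj 0).smulRight ![1, c]) (fun x => by simp [mem_lineSub]) fun x hx => by
      rw [mem_lineSub] at hx
      ext i
      fin_cases i
      · simp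
      · simp [hx]
  rank_eq p := by
    have : Nontrivial R := p.nontrivial
    let e : lineSub c ≃ₗ[R] R :=
      { toFun := fun x => x.1 0
        map_add' := fun _ _ => rfl
        map_smul' := fun _ _ => rfl
        invFun := fun a => ⟨a • ![1, c], by simp [mem_lineSub]⟩
        left_inv := fun x => by
          have := mem_lineSub.1 x.2
          ext i
          fin_cases i
          · simp
          · simp [this]
        right_inv := fun a => by simp }
    rw [Module.rankAtStalk_eq_of_equiv e]
    simp

lemma pullbackSub_lineSub {R' : Type u} [CommRing R'] (g : R →+* R') (c : R) :
    pullbackSub g (lineSub c) = lineSub (g c) := by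
  rw [lineSub, pullbackSub_span, Set.image_singleton, lineSub]
  congr 2
  ext i
  fin_cases i <;> simp

/-- Locally both vectors are multiples of one vector, so the `2 × 2` minor vanishes. -/
lemma IsSubbundle.mul_comm_coords {M : Submodule R (Fin 2 → R)} (h : IsSubbundle 1 M)
    {x y : Fin 2 → R} (hx : x ∈ M) (hy : y ∈ M) : x 0 * y 1 = x 1 * y 0 := by
  rw [← sub_eq_zero]
  refine eq_zero_of_forall_localization fun p => ?_
  obtain ⟨e, he⟩ := h.exists_local_generators p
  obtain ⟨cx, hx⟩ := he x hx
  obtain ⟨cy, hy⟩ := he y hy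
  simp only [map_sub, map_mul, hx, hy, Fin.sum_univ_one]
  ring

lemma pullbackSub_mul_comm_coords {R' : Type u} [CommRing R'] (g : R →+* R')
    {M : Submodule R (Fin 2 → R)} (h : ∀ x ∈ M, ∀ y ∈ M, x 0 * y 1 = x 1 * y 0) :
    ∀ x ∈ pullbackSub g M, ∀ y ∈ pullbackSub g M, x 0 * y 1 = x 1 * y 0 := by
  intro x hx y hy
  induction hx using Submodule.span_induction with
  | zero => simp
  | add x x' _ _ h1 h2 => simp only [Pi.add_apply]; linear_combination h1 + h2
  | smul r x _ h1 => simp only [Pi.smul_apply, smul_eq_mul]; linear_combination r * h1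
  | mem x hx =>
  obtain ⟨x, hx, rfl⟩ := hx
  induction hy using Submodule.span_induction with
  | zero => simp
  | add x x' _ _ h1 h2 => simp only [Pi.add_apply]; linear_combination h1 + h2
  | smul r x _ h1 => simp only [Pi.smul_apply, smul_eq_mul]; linear_combination r * h1
  | mem y hy =>
  obtain ⟨y, hy, rfl⟩ := hy
  simp only [← map_mul, h x hx y hy]

/-- The ideal of the first coordinates of the elements of a submodule. -/
def firstIdeal (M : Submodule R (Fin 2 → R)) : Ideal R := M.map (LinearMap.proj 0)

lemma mem_firstIdeal {M : Submodule R (Fin 2 → R)} {r : R} :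
    r ∈ firstIdeal M ↔ ∃ x ∈ M, x 0 = r := Iff.rfl

lemma firstIdeal_pullback {R' : Type u} [CommRing R'] (g : R →+* R')
    (M : Submodule R (Fin 2 → R)) : firstIdeal (pullbackSub g M) = (firstIdeal M).map g := by
  rw [firstIdeal, pullbackSub, Submodule.map_span, Ideal.map, firstIdeal, Ideal.span]
  congr 1
  ext r
  simp

/-- An element `x` of `M` with first coordinate `1` spans `M`: the vanishing minors force `y = y₀
x`. -/
lemma firstIdeal_eq_top_iff {M : Submodule R (Fin 2 → R)}
    (h : ∀ x ∈ M, ∀ y ∈ M, x 0 * y 1 = x 1 * y 0) :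
    firstIdeal M = ⊤ ↔ ∃ c, lineSub c = M := by
  rw [Ideal.eq_top_iff_one, mem_firstIdeal]
  constructor
  · rintro ⟨x, hx, hx0⟩
    have hx' : x = ![1, x 1] := by
      ext i
      fin_cases i
      · exact hx0
      · rfl
    refine ⟨x 1, le_antisymm (Submodule.span_le.2 ?_) fun y hy => ?_⟩
    · rwa [Set.singleton_subset_iff, ← hx']
    · rw [mem_lineSub]
      have := h x hx y hy
      rw [hx0] at this
      linear_combination this
  · rintro ⟨c, rfl⟩
    exact ⟨![1, c], Submodule.mem_span_singleton_self _, rfl⟩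

lemma lineSub_injective : Function.Injective (lineSub (R := R)) := by
  intro c c' h
  have : ![1, c] ∈ lineSub c' := h ▸ Submodule.mem_span_singleton_self _
  simpa [mem_lineSub] using this

end Line

section AffineSpaces

variable {k : Scheme.{u}}

/-- The coordinate of a point of the affine line over `X`. -/
def lineCoord {X : Over k} {R : CommRingCat.{u}} (y : Spec R ⟶ (X ⊗ affineLine k).left) : R :=
  (Scheme.ΓSpecIso R).hom (y.appTop (coordsOf (snd X (affineLine k)) ⟨⟩))

lemma lineCoord_comp {X : Over k} {R R' : CommRingCat.{u}} (g : R ⟶ R')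
    (y : Spec R ⟶ (X ⊗ affineLine k).left) : lineCoord (Spec.map g ≫ y) = g.hom (lineCoord y) :=
  ConcreteCategory.congr_hom (Scheme.ΓSpecIso_naturality g)
    (y.appTop (coordsOf (snd X (affineLine k)) ⟨⟩))

lemma lineCoord_ext {X : Over k} {R : CommRingCat.{u}} {y y' : Spec R ⟶ (X ⊗ affineLine k).left}
    (h : y ≫ (fst X (affineLine k)).left = y' ≫ (fst X (affineLine k)).left)
    (h' : lineCoord y = lineCoord y') : y = y' := by
  let T : Over k := Over.mk (y ≫ (X ⊗ affineLine k).hom)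
  have hw : y' ≫ (X ⊗ affineLine k).hom = y ≫ (X ⊗ affineLine k).hom := by
    rw [← Over.w (fst X (affineLine k)), ← Category.assoc, ← h, Category.assoc]
  let f : T ⟶ X ⊗ affineLine k := Over.homMk y
  let f' : T ⟶ X ⊗ affineLine k := Over.homMk y' hw
  have : f = f' := by
    ext1
    · ext1
      exact h
    · refine coordsOf_injective ?_
      rw [coordsOf_comp, coordsOf_comp]
      ext j
      exact (ConcreteCategory.bijective_of_isIso (Scheme.ΓSpecIso R).hom).1 h'
  exact congrArg (fun f => f.left) this

lemma exists_lineCoord_eq {X : Over k} {R : CommRingCat.{u}} (x : Spec R ⟶ X.left) (c : R) :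
    ∃ y : Spec R ⟶ (X ⊗ affineLine k).left,
      y ≫ (fst X (affineLine k)).left = x ∧ lineCoord y = c := by
  let T : Over k := Over.mk (x ≫ X.hom)
  let f : T ⟶ X := Over.homMk x
  let v : Γ(T.left, ⊤) := (Scheme.ΓSpecIso R).inv c
  let y : T ⟶ X ⊗ affineLine k := lift f (pointOf T fun _ => v)
  refine ⟨y.left, ?_, ?_⟩
  · rw [← Over.comp_left, lift_fst]
    rfl
  · have h := coordsOf_comp y (snd X (affineLine k))
    rw [lift_snd, coordsOf_pointOf] at h
    have h' : v = y.left.appTop (coordsOf (snd X (affineLine k)) ⟨⟩) := congrFun h ⟨⟩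
    rw [lineCoord, ← h']
    exact ConcreteCategory.congr_hom (Scheme.ΓSpecIso R).inv_hom_id c

/-- The affine line is the open part of `Gr(1, 2) = P¹` consisting of the lines spanned by some `(1,
c)`. This is what brings affine spaces into `V`. -/
lemma isOpenInGrassmannian_fst (X : Over k) :
    IsOpenInGrassmannian 1 2 (fst X (affineLine k)) := by
  refine isOpenInGrassmannian_of_ideal _ (fun y => lineSub (lineCoord y))
    (fun y => isSubbundle_lineSub _) (fun g y => ?_) (fun y y' h h' => ?_) fun {R} M hM => ?_
  · rw [lineCoord_comp, pullbackSub_lineSub]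
  · exact lineCoord_ext h (lineSub_injective h')
  · refine ⟨firstIdeal M, fun {R'} g x => ?_⟩
    rw [← firstIdeal_pullback, firstIdeal_eq_top_iff (pullbackSub_mul_comm_coords g.hom
      fun x hx y hy => hM.mul_comm_coords hx hy)]
    constructor
    · rintro ⟨y, -, hy⟩
      exact ⟨_, hy⟩
    · rintro ⟨c, hc⟩
      obtain ⟨y, hy, rfl⟩ := exists_lineCoord_eq x c
      exact ⟨y, hy, hc⟩

lemma isAffineHom_fst (X : Over k) {L : Over k} (h : IsAffineHom L.hom) :
    IsAffineHom (fst X L).left :=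
  MorphismProperty.of_isPullback (P := @IsAffineHom)
    (IsPullback.of_hasPullback X.hom L.hom).flip h

lemma isAffineHom_snd (X : Over k) {L : Over k} (h : IsAffineHom L.hom) :
    IsAffineHom (snd L X).left :=
  MorphismProperty.of_isPullback (P := @IsAffineHom)
    (IsPullback.of_hasPullback L.hom X.hom) h

variable {V : ObjectProperty (Over k)} (hV : IsAdmissible V)

include hV in
lemma IsAdmissible.line_mem {X : Over k} (hX : V X) : V (X ⊗ affineLine k) :=
  hV.grassmannian_mem (fst X (affineLine k)) 1 2 hX
    (isAffineHom_fst X (inferInstanceAs (IsAffineHom (𝔸(PUnit; k) ↘ k))))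
    (isOpenInGrassmannian_fst X)

/-- Reindexing of the coordinates. -/
def affineSpReindex {ι ι' : Type u} (e : ι ≃ ι') : affineSp k ι ≅ affineSp k ι' where
  hom := pointOf _ fun j => coordsOf (𝟙 _) (e.symm j)
  inv := pointOf _ fun j => coordsOf (𝟙 _) (e j)
  hom_inv_id := coordsOf_injective (by
    rw [coordsOf_comp, coordsOf_pointOf]
    ext j
    rw [← congrFun (coordsOf_comp _ (𝟙 _)) (e j), Category.comp_id, coordsOf_pointOf,
      e.symm_apply_apply])
  inv_hom_id := coordsOf_injective (by
    rw [coordsOf_comp, coordsOf_pointOf]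
    ext j
    rw [← congrFun (coordsOf_comp _ (𝟙 _)) (e.symm j), Category.comp_id, coordsOf_pointOf,
      e.apply_symm_apply])

/-- The first coordinates of a point of an affine space. -/
def affineSpFst (ι : Type u) : affineSp k (Option ι) ⟶ affineSp k ι :=
  pointOf _ fun j => coordsOf (𝟙 _) (some j)

/-- The last coordinate of a point of an affine space. -/
def affineSpSnd (ι : Type u) : affineSp k (Option ι) ⟶ affineLine k :=
  pointOf _ fun _ => coordsOf (𝟙 _) none

lemma coordsOf_affineSpFst {ι : Type u} {T : Over k} (x : T ⟶ affineSp k (Option ι)) (j : ι) :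
    coordsOf (x ≫ affineSpFst ι) j = coordsOf x (some j) := by
  rw [coordsOf_comp, affineSpFst, coordsOf_pointOf]
  beta_reduce
  rw [← congrFun (coordsOf_comp _ (𝟙 _)) (some j), Category.comp_id]

lemma coordsOf_affineSpSnd {ι : Type u} {T : Over k} (x : T ⟶ affineSp k (Option ι)) :
    coordsOf (x ≫ affineSpSnd ι) ⟨⟩ = coordsOf x none := by
  rw [coordsOf_comp, affineSpSnd, coordsOf_pointOf, ← congrFun (coordsOf_comp _ (𝟙 _)) none,
    Category.comp_id]

lemma affineSp_option_ext {ι : Type u} {T : Over k} {x y : T ⟶ affineSp k (Option ι)}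
    (h : x ≫ affineSpFst ι = y ≫ affineSpFst ι) (h' : x ≫ affineSpSnd ι = y ≫ affineSpSnd ι) :
    x = y := by
  refine coordsOf_injective (funext fun j => ?_)
  cases j with
  | none => rw [← coordsOf_affineSpSnd, h', coordsOf_affineSpSnd]
  | some j => rw [← coordsOf_affineSpFst, h, coordsOf_affineSpFst]

lemma exists_affineSp_option {ι : Type u} {T : Over k} (x : T ⟶ affineSp k ι)
    (a : T ⟶ affineLine k) : ∃ y : T ⟶ affineSp k (Option ι),
      y ≫ affineSpFst ι = x ∧ y ≫ affineSpSnd ι = a := by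
  refine ⟨pointOf T fun j => j.elim (coordsOf a ⟨⟩) (coordsOf x), coordsOf_injective ?_,
    coordsOf_injective ?_⟩
  · ext j
    rw [coordsOf_affineSpFst, coordsOf_pointOf]
    rfl
  · ext ⟨⟩
    rw [coordsOf_affineSpSnd, coordsOf_pointOf]
    rfl

/-- The projection to the last factor, up to reordering of the factors. -/
lemma exists_affineSp_option_iso (ι : Type u) (S : Over k) :
    ∃ e : (affineSp k ι ⊗ S) ⊗ affineLine k ≅ affineSp k (Option ι) ⊗ S,
      e.hom ≫ snd _ _ = fst _ _ ≫ snd _ _ := by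
  obtain ⟨y, hy, hy'⟩ := exists_affineSp_option
    (fst (affineSp k ι ⊗ S) (affineLine k) ≫ fst _ _) (snd (affineSp k ι ⊗ S) (affineLine k))
  refine ⟨⟨lift y (fst _ _ ≫ snd _ _),
    lift (lift (fst _ _ ≫ affineSpFst ι) (snd _ _)) (fst _ _ ≫ affineSpSnd ι), ?_, ?_⟩, ?_⟩
  · ext1
    · ext1
      · simp [hy]
      · simp
    · simp [hy']
  · ext1
    · refine affineSp_option_ext ?_ ?_
      · simp [hy]
      · simp [hy']
    · simp
  · simp

/-- Homotopy invariance for affine spaces. -/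
lemma CohomologyTheory.isIso_pull_affineSp {hV : IsAdmissible V} (A : CohomologyTheory.{w} hV)
    (ι : Type u) [Finite ι] {S : Over k} (hS : V S) :
    ∃ h : V (affineSp k ι ⊗ S), IsIso (A.pull h hS (snd (affineSp k ι) S)) := by
  induction ι using Finite.induction_empty_option with
  | of_equiv e H =>
    obtain ⟨h, H⟩ := H
    let e' := MonoidalCategory.whiskerRightIso (affineSpReindex (k := k) e) S
    have h' := hV.iso_mem e' h
    refine ⟨h', ?_⟩
    have h1 := A.pull_comp h' h hS e'.inv (snd _ S)
    have h2 : e'.inv ≫ snd _ S = snd _ S := by simp [e']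
    rw [h2] at h1
    rw [h1]
    infer_instance
  | h_empty =>
    let f : affineSp k PEmpty.{u + 1} ⊗ S ⟶ S := snd _ S
    have : IsIso f := by
      refine ⟨lift (pointOf S fun j => j.elim) (𝟙 S), ?_, lift_snd _ _⟩
      ext1
      · exact coordsOf_injective (funext fun j => j.elim)
      · simp [f]
    exact ⟨hV.iso_mem (asIso f).symm hS, A.isIso_pull _ _ f⟩
  | @h_option ι _ H =>
    obtain ⟨h, H⟩ := H
    obtain ⟨e, he⟩ := exists_affineSp_option_iso (k := k) ι S
    have h₁ := hV.line_mem h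
    have h₂ := hV.iso_mem e h₁
    refine ⟨h₂, ?_⟩
    have i₁ : IsIso (A.pull h₁ h (fst _ _)) := A.homotopy _ h h₁
    have h3 := A.pull_comp h₁ h₂ hS e.hom (snd _ S)
    rw [he, A.pull_comp h₁ h hS] at h3
    have : IsIso (A.pull h₂ hS (snd _ S) ≫ A.pull h₁ h₂ e.hom) := by
      rw [← h3]; infer_instance
    exact IsIso.of_isIso_comp_right _ (A.pull h₁ h₂ e.hom)

end AffineSpaces

end QuatProj

end
noncomputable section

namespace QuatProj

/-! ### Schemes of Plücker coordinates in admissible categories. -/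

section PluckerMem

/-- Reindexing of a matrix. -/
def reindexMat {R : Type u} {κ κ' : Type} (e : κ ≃ κ') (W : κ → κ → R) (a b : κ') : R :=
  W (e.symm a) (e.symm b)

lemma IsPlucker.reindex {R : Type u} [CommRing R] {κ κ' J : Type} [Fintype J] {s t : J → κ}
    {W : κ → κ → R} (h : IsPlucker s t W) (e : κ ≃ κ') :
    IsPlucker (e ∘ s) (e ∘ t) (reindexMat e W) where
  alt a := h.alt _
  skew a b := h.skew _ _
  rel a b c d := h.rel _ _ _ _
  norm := by simpa [reindexMat] using h.norm

variable {k : Scheme.{u}} {κ J : Type} [Fintype J] {s t : J → κ} {S : Over k}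

/-- The Plücker coordinates of an affine point of `pluckerScheme s t k × S`. -/
def prodCoords {R : CommRingCat.{u}} (y : Spec R ⟶ (pluckerScheme s t k ⊗ S).left) (a b : κ) : R :=
  (Scheme.ΓSpecIso R).hom (pluckerCoords (y ≫ (fst (pluckerScheme s t k) S).left) a b)

lemma isPlucker_prodCoords {R : CommRingCat.{u}} (y : Spec R ⟶ (pluckerScheme s t k ⊗ S).left) :
    IsPlucker s t (prodCoords y) :=
  (isPlucker_pluckerCoords _).map (Scheme.ΓSpecIso R).hom.hom

lemma prodCoords_comp {R R' : CommRingCat.{u}} (g : R ⟶ R')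
    (y : Spec R ⟶ (pluckerScheme s t k ⊗ S).left) :
    prodCoords (Spec.map g ≫ y) = fun a b => g.hom (prodCoords y a b) := by
  ext a b
  have := ConcreteCategory.congr_hom (Scheme.ΓSpecIso_naturality g)
    (pluckerCoords (y ≫ (fst (pluckerScheme s t k) S).left) a b)
  simp only [prodCoords, Category.assoc, pluckerCoords_comp (Spec.map g)]
  exact this

lemma prodCoords_ext {R : CommRingCat.{u}} {y y' : Spec R ⟶ (pluckerScheme s t k ⊗ S).left}
    (h : y ≫ (snd (pluckerScheme s t k) S).left = y' ≫ (snd (pluckerScheme s t k) S).left)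
    (h' : prodCoords y = prodCoords y') : y = y' := by
  let T : Over k := Over.mk (y ≫ (pluckerScheme s t k ⊗ S).hom)
  have hw : y' ≫ (pluckerScheme s t k ⊗ S).hom = y ≫ (pluckerScheme s t k ⊗ S).hom := by
    rw [← Over.w (snd (pluckerScheme s t k) S), ← Category.assoc, ← h, Category.assoc]
  let f : T ⟶ pluckerScheme s t k ⊗ S := Over.homMk y
  let f' : T ⟶ pluckerScheme s t k ⊗ S := Over.homMk y' hw
  have : f = f' := by
    ext1
    · ext1
      refine pluckerScheme_hom_ext (by simp only [Over.w]) ?_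
      ext a b
      exact (ConcreteCategory.bijective_of_isIso (Scheme.ΓSpecIso R).hom).1
        (congrFun (congrFun h' a) b)
    · ext1
      exact h
  exact congrArg (fun f => f.left) this

lemma exists_prodCoords_eq {R : CommRingCat.{u}} (x : Spec R ⟶ S.left) {W : κ → κ → R}
    (hW : IsPlucker s t W) : ∃ y : Spec R ⟶ (pluckerScheme s t k ⊗ S).left,
      y ≫ (snd (pluckerScheme s t k) S).left = x ∧ prodCoords y = W := by
  let T : Over k := Over.mk (x ≫ S.hom)
  let f : T ⟶ S := Over.homMk x
  obtain ⟨g, hg, hgW⟩ := exists_pluckerCoords_eq (x ≫ S.hom)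
    (hW.map (Scheme.ΓSpecIso R).inv.hom)
  let g' : T ⟶ pluckerScheme s t k := Over.homMk g hg
  refine ⟨(lift g' f).left, ?_, ?_⟩
  · rw [← Over.comp_left, lift_snd]
    rfl
  · have h : (lift g' f).left ≫ (fst (pluckerScheme s t k) S).left = g := by
      rw [← Over.comp_left, lift_fst]
      rfl
    ext a b
    rw [prodCoords, h, hgW]
    exact ConcreteCategory.congr_hom (Scheme.ΓSpecIso R).inv_hom_id (W a b)

/-- A rank `2` subbundle comes from Plücker coordinates exactly when its value ideal is the unit
ideal, a condition compatible with base change; the coordinates are then unique. -/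
lemma isOpenInGrassmannian_snd {N : ℕ} (e : κ ≃ Fin N) :
    IsOpenInGrassmannian 2 N (snd (pluckerScheme s t k) S) := by
  refine isOpenInGrassmannian_of_ideal _ (fun y => rowSpan (reindexMat e (prodCoords y)))
    (fun y => ((isPlucker_prodCoords y).reindex e).isSubbundle) (fun g y => ?_)
    (fun y y' h h' => ?_) fun {R} M hM => ?_
  · rw [prodCoords_comp, pullbackSub_rowSpan]
    rfl
  · refine prodCoords_ext h ?_
    have := ((isPlucker_prodCoords y).reindex e).eq_of_rowSpan_eq
      ((isPlucker_prodCoords y').reindex e) h'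
    ext a b
    simpa [reindexMat] using congrFun (congrFun this (e a)) (e b)
  · refine ⟨valueIdeal (e ∘ s) (e ∘ t) M, fun {R'} g x => ?_⟩
    rw [← valueIdeal_pullback]
    constructor
    · rintro ⟨y, -, hy⟩
      rw [← hy]
      exact ((isPlucker_prodCoords y).reindex e).valueIdeal_eq_top
    · intro h
      obtain ⟨W, hW, hM'⟩ := (hM.minorsVanish.pullback g.hom).exists_isPlucker h
      have hW' := hW.reindex e.symm
      simp only [← Function.comp_assoc, Equiv.symm_comp_self, Function.id_comp] at hW'
      obtain ⟨y, hy, hyW⟩ := exists_prodCoords_eq x hW'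
      refine ⟨y, hy, ?_⟩
      rw [hyW, ← hM']
      congr 1
      ext a b
      simp [reindexMat]

lemma IsAdmissible.pluckerScheme_mem [Finite κ] {V : ObjectProperty (Over k)}
    (hV : IsAdmissible V) (s t : J → κ) (hS : V S) : V (pluckerScheme s t k ⊗ S) := by
  obtain ⟨N, ⟨e⟩⟩ := Finite.exists_equiv_fin κ
  exact hV.grassmannian_mem (snd (pluckerScheme s t k) S) 2 N hS
    (isAffineHom_snd S inferInstance) (isOpenInGrassmannian_snd e)

end PluckerMem

/-! ### Membership and cohomology of the strata. -/

section Stratum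

variable {k : Scheme.{u}} {n i : ℕ}

lemma isPullback_whiskerRight {X Y : Over k} (f : X ⟶ Y) (S : Over k) :
    IsPullback (fst X S) (f ▷ S) f (fst Y S) :=
  (isPullback_whiskerRight_fst f S).flip

lemma isCompact_preimage_offHyperplane {κ J : Type} [Fintype J] [Finite κ] {s t : J → κ}
    {T : Scheme.{u}} [CompactSpace T] (f : T ⟶ (pluckerScheme s t k).left) (c : κ) :
    IsCompact ((f ⁻¹ᵁ offHyperplane c : T.Opens) : Set T) := by
  rw [preimage_offHyperplane, TopologicalSpace.Opens.coe_iSup]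
  exact isCompact_iUnion fun a => AlgebraicGeometry.isCompact_basicOpen _ isCompact_univ _

lemma IsAdmissible.openSub_tensor_mem {V : ObjectProperty (Over k)} (hV : IsAdmissible V)
    {X S : Over k} (h : V (X ⊗ S)) (U : X.left.Opens)
    (hU : IsCompact (((fst X S).left ⁻¹ᵁ U : (X ⊗ S).left.Opens) : Set (X ⊗ S).left)) :
    V (openSub X U ⊗ S) :=
  hV.iso_mem ((isPullback_openRestrict (fst X S) U).isoIsPullback _ _
    (isPullback_whiskerRight_fst (openIncl X U) S)) (hV.open_mem h _ hU)

/-- The stratum is a finite union of basic opens, so its product with `S` is a quasi-compact open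
subscheme of a scheme already in `V`. -/
lemma IsAdmissible.stratum_mem {V : ObjectProperty (Over k)} (hV : IsAdmissible V) {S : Over k}
    (hS : V S) : V (stratumScheme k n i ⊗ S) := by
  have hX := hV.pluckerScheme_mem (perpSrc n i) (perpTgt n i) hS
  have := hV.compactSpace hX
  exact hV.openSub_tensor_mem hX _ (isCompact_preimage_offHyperplane _ _)

/-- A lift `s` trivializes the torsor by `(x, t) ↦ t · s(x)`: pull the square `G_a × E ≅ E ×_Y E`
back along `s`. -/
lemma trivOver_of_lift {E Y T : Over k} {σ : affineLine k ⊗ E ⟶ E} {p : E ⟶ Y}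
    (h : IsPullback σ (snd (affineLine k) E) p p) {f : T ⟶ Y} (s : T ⟶ E) (hs : s ≫ p = f) :
    TrivOver p f := by
  have h₁ : IsPullback (lift (snd T (affineLine k)) (fst T (affineLine k) ≫ s))
      (fst T (affineLine k)) (snd (affineLine k) E) s := by
    refine ⟨⟨by simp⟩, ⟨PullbackCone.IsLimit.mk _
      (fun c => lift c.snd (c.fst ≫ fst _ _)) (fun c => ?_) (fun c => ?_) fun c m h₁ h₂ => ?_⟩⟩
    · ext1
      · simp
      · simpa using c.condition.symm
    · simp
    · ext1
      · simpa using h₂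
      · simp [← h₁]
  have h₂ := h₁.paste_horiz h
  rw [hs] at h₂
  exact ⟨_, h₂⟩

lemma TrivOver.baseChange {E Y E' Y' T T' : Over k} {p : E ⟶ Y} {p' : E' ⟶ Y'} {q : E' ⟶ E}
    {g : Y' ⟶ Y} (hp : IsPullback q p' p g) {f : T ⟶ Y} (h : TrivOver p f) (f' : T' ⟶ Y')
    (r : T' ⟶ T) (hr : f' ≫ g = r ≫ f) : TrivOver p' f' := by
  obtain ⟨τ, hτ⟩ := h.precomp r
  rw [← hr] at hτ
  refine ⟨hp.lift τ (fst _ _ ≫ f') (by rw [hτ.w, Category.assoc]), ?_⟩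
  refine IsPullback.of_right ?_ (hp.lift_snd _ _ _) hp
  rwa [hp.lift_fst]

lemma exists_trivOver_cellProj (S : Over k) (x : (stratumScheme k n i ⊗ S).left) :
    ∃ D : (stratumScheme k n i ⊗ S).left.Opens, x ∈ D ∧
      TrivOver (cellProj k n i ▷ S) (openIncl (stratumScheme k n i ⊗ S) D) := by
  let g := fst (stratumScheme k n i) S
  -- The affine open is chosen in the stratum itself, where sections are available, and its preimage
  -- is then used in the product with `S`.
  obtain ⟨U, hU, hxU⟩ := exists_isAffineOpen_mem_and_subset (U := ⊤) (x := g.left x) trivial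
  have : IsAffine U := hU
  obtain ⟨s, hs⟩ := exists_cellProj_lift U.ι
  let s' : openSub (stratumScheme k n i) U ⟶ affineSp k (CellIdx.{u} n i) := Over.homMk s (by
    change s ≫ (affineSp k (CellIdx.{u} n i)).hom = U.ι ≫ (stratumScheme k n i).hom
    rw [← hs, Category.assoc, Over.w])
  have hs' : s' ≫ cellProj k n i = openIncl (stratumScheme k n i) U := by
    ext1
    exact hs
  refine ⟨g.left ⁻¹ᵁ U, hxU.1, ?_⟩
  exact (trivOver_of_lift isPullback_cellProj s' hs').baseChange
    (isPullback_whiskerRight (cellProj k n i) S) _ (openRestrict g U)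
    (isPullback_openRestrict g U).w

/-- Two out of three: the projection of affine space to `S` factors through the stratum, and both
this projection and the torsor induce isomorphisms. -/
lemma CohomologyTheory.isIso_pull_stratumScheme {V : ObjectProperty (Over k)}
    {hV : IsAdmissible V} (A : CohomologyTheory.{w} hV) {S : Over k} (hS : V S) :
    ∃ h : V (stratumScheme k n i ⊗ S), IsIso (A.pull h hS (snd (stratumScheme k n i) S)) := by
  have hX : V (stratumScheme k n i ⊗ S) := hV.stratum_mem hS
  obtain ⟨hP, h₁⟩ := A.isIso_pull_affineSp (CellIdx.{u} n i) hS
  have h₂ : IsIso (A.pull hP hX (cellProj k n i ▷ S)) :=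
    CohomologyTheory.isIso_pull_of_locally_trivOver _ hP hX (exists_trivOver_cellProj S)
  refine ⟨hX, ?_⟩
  have h₃ := A.pull_comp hP hX hS (cellProj k n i ▷ S) (snd _ S)
  rw [whiskerRight_snd] at h₃
  have : IsIso (A.pull hX hS (snd (stratumScheme k n i) S) ≫
      A.pull hP hX (cellProj k n i ▷ S)) := by
    rw [← h₃]
    exact h₁
  exact IsIso.of_isIso_comp_right _ (A.pull hP hX (cellProj k n i ▷ S))

end Stratum

end QuatProj

end

theorem theoremA (k : Scheme.{u}) (n i : ℕ) (hi : i ≤ n) :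
    (∃ X : Over k, Nonempty (IsStratum n i X)) ∧
    ∀ X : Over k, IsStratum n i X →
      (IsGaAction (cellAction k n i) ∧ IsFreeGa (cellAction k n i) ∧
        ∃ π : affineSp k (CellIdx.{u} n i) ⟶ X, IsGaQuotient (cellAction k n i) π) ∧
      ∀ (V : ObjectProperty (Over k)) (hV : IsAdmissible V) (A : CohomologyTheory.{w} hV)
        (S : Over k) (hS : V S),
        ∃ hXS : V (X ⊗ S), IsIso (A.pull hXS hS (snd X S)) := by
  refine ⟨⟨_, ⟨isStratum_stratumScheme hi⟩⟩, fun X hX => ?_⟩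
  -- The remaining claims are invariant under isomorphism, so they transfer from the model to `X`.
  obtain ⟨e⟩ := (isStratum_stratumScheme hi).nonempty_iso hX
  refine ⟨⟨isGaAction_cellAction, isFreeGa_cellAction, _, isGaQuotient_of_iso e⟩, ?_⟩
  intro V hV A S hS
  obtain ⟨h, hA⟩ := A.isIso_pull_stratumScheme (n := n) (i := i) hS
  let e' := whiskerRightIso e S
  have h' : V (X ⊗ S) := hV.iso_mem e' h
  refine ⟨h', ?_⟩
  have h₁ := A.pull_comp h' h hS e'.inv (snd _ S)
  have h₂ : e'.inv ≫ snd _ S = snd X S := whiskerRight_snd _ _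
  rw [h₂] at h₁
  rw [h₁]
  infer_instance
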